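/- **Setting.** $M\ge 2$ machines have objectives $F_m:\mathbb R^d\to\mathbb R$, and $F=\frac1M\sum_m F_m$. For $H>0$, $\Delta,\zeta\ge 0$ and $0\le\tau\le 2H$, let $\mathcal P(H,\Delta,\tau,\zeta)$ be the class of all such problems (of any dimension $d$) with twice differentiable $F_m$ such that for all $m,n$ and $x,y$: $\|\nabla F_m(x)-\nabla F_m(y)\|\le H\|x-y\|$; $F(0)-\inf F\le\Delta$; $\|\nabla^2F_m(x)-\nabla^2F_n(x)\|\le\tau$; $\|\nabla F_m(x)-\nabla F_n(x)\|\le H\zeta$. A stochastic two-point oracle with variance $\sigma^2$ on machine $m$, queried at a pair $(x_1,x_2)$, draws a fresh $z\sim\mathcal D_m$ and returns $(s_z(x_i),g_z(x_i))_{i=1,2}$, where $\mathbb E\,s_z(x)=F_m(x)$, $\mathbb E\,g_z(x)=\nabla F_m(x)$, $\mathbb E\|g_z(x)-\nabla F_m(x)\|^2\le\sigma^2$ and $\mathbb E\|g_z(x)-g_z(y)\|\le H\|x-y\|$ for all $x,y$. A distributed zero-respecting algorithm with $R$ communication rounds and $K$ oracle calls per machine per round chooses each query as a deterministic measurable function of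 all answers of all machines in earlier rounds and of the machine's own earlier answers in the current round; the query points are supported on the union of the supports of the gradient vectors in those answers. Its output $x_R$ is a deterministic measurable function of all answers, supported on the union of the supports of all gradient vectors received. **Theorem.** (i) There is a universal constant $c>0$ such that for all $M\ge2$, $K\ge1$, $R\ge1$, $H>0$, $\Delta,\zeta,\sigma\ge0$ and $0\le\tau\le2H$ with $\frac{\sigma^2}{MKR}\le\Delta H$ there are a problem in $\mathcal P(H,\Delta,\tau,\zeta)$ and two-point oracles for it with variance $\sigma^2$ such that the output $x_R$ of every distributed zero-respecting algorithm satisfies $$\mathbb E\|\nabla F(x_R)\|^2\ \ge\ c\left(\min\Big\{\frac{H^2\zeta^2}{R},\frac{\Delta\tau}{R}\Big\}+\frac{\Delta H}{KR}+\frac{\sigma^2}{MKR}+\Big(\frac{\sigma\Delta H}{MKR}\Big)^{2/3}\right).$$ (ii) Consequently CE-LSGD is minimax optimal in the deterministic case when $\Delta\tau\le H^2\zeta^2$. Here CE-LSGD with exact gradients, step size $\eta$ and $N$ iterations starts at $x_0=0$; in iteration $r=0,\dots,N-1$ it computes $v_r=\frac1M\sum_m\nabla F_m(x_r)$, samples a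 uniformly random machine $m$ (independently of the past), sets $w_{r+1,0}=w_{r+1,1}=x_r$, $v_{r,0}=v_r$ and, for $k=1,\dots,Q_r$ with $Q_0=1$ and $Q_r=K$ for $r\ge1$, $$v_{r,k}=v_{r,k-1}+\nabla F_m(w_{r+1,k})-\nabla F_m(w_{r+1,k-1}),\qquad w_{r+1,k+1}=w_{r+1,k}-\eta v_{r,k},$$ and then sets $x_{r+1}=w_{r+1,Q_r+1}$; its output $\tilde x$ is uniform among all $w_{r+1,k}$ with $0\le r<N$, $1\le k\le Q_r$. Each iteration uses two communication rounds. There are universal constants $a,C>0$ such that for all $M\ge2$, $K\ge1$, $N\ge2$, $H>0$, $\Delta,\zeta\ge0$ and $0\le\tau\le2H$ with $\Delta\tau\le H^2\zeta^2$, CE-LSGD with $\eta=a\min\{\frac1H,\frac1{K\tau}\}$ satisfies, on every problem in $\mathcal P(H,\Delta,\tau,\zeta)$, $$\mathbb E\|\nabla F(\tilde x)\|^2\ \le\ C\cdot\inf_A\sup_P\ \mathbb E\|\nabla F(x^A_{2N})\|^2,$$ where $A$ ranges over the distributed zero-respecting algorithms with $2N$ communication rounds and $K$ oracle calls per machine per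 round, and $P$ over the problems in $\mathcal P(H,\Delta,\tau,\zeta)$ with two-point oracles of variance $0$. -/

import Mathlib

open MeasureTheory
open scoped ENNReal

noncomputable section

namespace DistOpt

/-- `ℝ^d` with the Euclidean norm. -/
abbrev Vec (d : ℕ) : Type := EuclideanSpace ℝ (Fin d)

/-- The set of nonzero coordinates of a vector. -/
def supp {d : ℕ} (v : Vec d) : Set (Fin d) := {i | v i ≠ 0}

/-- The average objective `F = (1/M) ∑ₘ Fₘ`. -/
def avg {M d : ℕ} (F : Fin M → Vec d → ℝ) (x : Vec d) : ℝ := (∑ m, F m x) / (M : ℝ)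

/-- The problem class: machine objectives that are twice differentiable and `H`-smooth, whose average
has initial suboptimality `F(0) - inf F ≤ Δ`, with second-order heterogeneity `τ` and uniform
first-order heterogeneity `H ζ`. -/
structure InClass {M d : ℕ} (F : Fin M → Vec d → ℝ) (H Δ τ ζ : ℝ) : Prop where
  differentiable : ∀ m, Differentiable ℝ (F m)
  twice_differentiable : ∀ m, Differentiable ℝ (gradient (F m))
  smooth : ∀ m x y, ‖gradient (F m) x - gradient (F m) y‖ ≤ H * ‖x - y‖
  subopt : ∀ x, avg F 0 - avg F x ≤ Δ
  second_order : ∀ m n x,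
    ‖fderiv ℝ (gradient (F m)) x - fderiv ℝ (gradient (F n)) x‖ ≤ τ
  first_order : ∀ m n x, ‖gradient (F m) x - gradient (F n) x‖ ≤ H * ζ

/-- What a two-point query is: two points of `ℝ^d`. -/
abbrev Query (d : ℕ) : Type := Fin 2 → Vec d

/-- What a two-point oracle answers: two function values and two gradient vectors. -/
abbrev Answer (d : ℕ) : Type := (Fin 2 → ℝ) × (Fin 2 → Vec d)

/-- The coordinates revealed by an answer, i.e. those in the support of a returned gradient. -/
def answerSupp {d : ℕ} (a : Answer d) : Set (Fin d) := ⋃ j, supp (a.2 j)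

/-- The data of stochastic first-order oracles on `M` machines: machine `m` draws `z ∼ D m`, and
a datum `z` yields the function values `s z x` and gradient estimates `g z x`. -/
structure Oracle (M d : ℕ) where
  Z : Type
  [measurableSpace : MeasurableSpace Z]
  D : Fin M → Measure Z
  [prob : ∀ m, IsProbabilityMeasure (D m)]
  s : Z → Vec d → ℝ
  g : Z → Vec d → Vec d

attribute [instance] Oracle.measurableSpace Oracle.prob

/-- The answer to a two-point query: the same datum is used at both points. -/
def Oracle.answer {M d : ℕ} (O : Oracle M d) (z : O.Z) (q : Query d) : Answer d :=
  (fun j => O.s z (q j), fun j => O.g z (q j))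

/-- The oracles are unbiased for `F`, have variance at most `σ²`, and are `H`-mean smooth. -/
structure Oracle.IsFor {M d : ℕ} (O : Oracle M d) (F : Fin M → Vec d → ℝ) (H σ : ℝ) : Prop where
  measurable_s : Measurable (fun p : O.Z × Vec d => O.s p.1 p.2)
  measurable_g : Measurable (fun p : O.Z × Vec d => O.g p.1 p.2)
  integrable_s : ∀ m x, Integrable (fun z => O.s z x) (O.D m)
  integrable_g : ∀ m x, Integrable (fun z => O.g z x) (O.D m)
  mean_s : ∀ m x, ∫ z, O.s z x ∂(O.D m) = F m x
  mean_g : ∀ m x, ∫ z, O.g z x ∂(O.D m) = gradient (F m) x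
  variance : ∀ m x, ∫⁻ z, ‖O.g z x - gradient (F m) x‖ₑ ^ 2 ∂(O.D m) ≤ ENNReal.ofReal (σ ^ 2)
  mean_smooth : ∀ m x y, ∫⁻ z, ‖O.g z x - O.g z y‖ₑ ∂(O.D m) ≤ ENNReal.ofReal (H * ‖x - y‖)

/-- A distributed zero-respecting algorithm initialized at `0`, with `M` machines, `R` rounds and `K`
two-point oracle calls per machine and round. The query of machine `m` at call `k` of round `r` is
a (measurable) function of all answers of all machines in the earlier rounds and of its own earlier
answers in the current round, and is supported on the coordinates which those answers revealed.
After round `R` the output is a function of all answers, supported on the revealed coordinates. -/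
structure ZRAlgorithm (M K R d : ℕ) where
  query : (r : Fin R) → (k : Fin K) → (m : Fin M) →
    (Fin r.val → Fin K → Fin M → Answer d) → (Fin k.val → Answer d) → Query d
  measurable_query : ∀ r k m, Measurable
    (fun h : (Fin r.val → Fin K → Fin M → Answer d) × (Fin k.val → Answer d) =>
      query r k m h.1 h.2)
  supp_query : ∀ r k m past loc j, supp (query r k m past loc j) ⊆
    (⋃ l, answerSupp (loc l)) ∪ (⋃ s, ⋃ l, ⋃ n, answerSupp (past s l n))
  output : (Fin R → Fin K → Fin M → Answer d) → Vec d
  measurable_output : Measurable output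
  supp_output : ∀ all, supp (output all) ⊆ ⋃ s, ⋃ l, ⋃ n, answerSupp (all s l n)

/-- The answers received during the run of the algorithm, when `z (r, k, m)` is the datum drawn by
machine `m` at call `k` of round `r`. -/
def transcript {M K R d : ℕ} (A : ZRAlgorithm M K R d) (O : Oracle M d)
    (z : Fin R × Fin K × Fin M → O.Z) (r : Fin R) (k : Fin K) (m : Fin M) : Answer d :=
  O.answer (z (r, k, m))
    (A.query r k m
      (fun r' k' m' => transcript A O z ⟨r'.val, r'.isLt.trans r.isLt⟩ k' m')
      (fun k' => transcript A O z r ⟨k'.val, k'.isLt.trans k.isLt⟩ m))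
termination_by (r.val, k.val)
decreasing_by
  · exact Prod.Lex.left _ _ r'.isLt
  · exact Prod.Lex.right _ k'.isLt

/-- `𝔼 ‖∇F(x_R)‖²` for the output `x_R` of the algorithm; all data are drawn independently. -/
def expectedError {M K R d : ℕ} (A : ZRAlgorithm M K R d) (F : Fin M → Vec d → ℝ)
    (O : Oracle M d) : ℝ≥0∞ :=
  ∫⁻ z, ‖gradient (avg F) (A.output (transcript A O z))‖ₑ ^ 2
    ∂(Measure.pi fun i : Fin R × Fin K × Fin M => O.D i.2.2)

/-- The min-max error of zero-respecting algorithms over the problem class. The class contains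
problems of every dimension, so an algorithm is given for every dimension. -/
def minimaxError (M K R : ℕ) (H Δ τ ζ σ : ℝ) : ℝ≥0∞ :=
  ⨅ A : (d : ℕ) → ZRAlgorithm M K R d,
    ⨆ (d : ℕ) (F : Fin M → Vec d → ℝ) (O : Oracle M d)
      (_ : InClass F H Δ τ ζ) (_ : O.IsFor F H σ), expectedError (A d) F O

/-! ### CE-LSGD with exact gradients and momentum parameter `β = 1` -/

/-- Local phase on the client with gradient map `G`, started at `x` with the estimate `v`. The value
at `k` is `(w_k, w_{k+1}, v_k)`, where `w_0 = w_1 = x`, `v_0 = v`,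
`v_k = v_{k-1} + G w_k - G w_{k-1}` and `w_{k+1} = w_k - η v_k`. -/
def localPhase {d : ℕ} (η : ℝ) (G : Vec d → Vec d) (x v : Vec d) : ℕ → Vec d × Vec d × Vec d
  | 0 => (x, x, v)
  | k + 1 =>
    let st := localPhase η G x v k
    let v' := st.2.2 + G st.2.1 - G st.1
    (st.2.1, st.2.1 - η • v', v')

/-- The number `Q` of local steps in iteration `r`: one if `r = 0`, otherwise `K`. -/
def localSteps (K r : ℕ) : ℕ := if r = 0 then 1 else K

/-- The local iterate `w_k` of an iteration started at `x`, run on client `m`; the starting estimate is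
the average over all machines of the exact gradients at `x`. -/
def localIterate {M d : ℕ} (η : ℝ) (F : Fin M → Vec d → ℝ) (m : Fin M) (x : Vec d) (k : ℕ) :
    Vec d :=
  (localPhase η (gradient (F m)) x ((M : ℝ)⁻¹ • ∑ n, gradient (F n) x) k).1

/-- The server iterate `x_r` if `client r` is the client sampled in iteration `r`; `x_0 = 0` and
`x_{r+1} = w_{Q+1}`. -/
def serverIterate {M d : ℕ} (η : ℝ) (K : ℕ) (F : Fin M → Vec d → ℝ) (client : ℕ → Fin M) :
    ℕ → Vec d
  | 0 => 0
  | r + 1 => localIterate η F (client r) (serverIterate η K F client r) (localSteps K r + 1)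

/-- `𝔼 ‖∇F(x̃)‖²` for `N ≥ 1` iterations of CE-LSGD: the clients are sampled independently and
uniformly, and the output `x̃` is uniform among the local iterates `w_1, …, w_Q` of all iterations. -/
def celsgdError {M d : ℕ} (η : ℝ) (K N : ℕ) (F : Fin M → Vec d → ℝ) : ℝ :=
  (∑ client : Fin N → Fin M, (∑ r : Fin N, ∑ k ∈ Finset.Icc 1 (localSteps K r),
      ‖gradient (avg F) (localIterate η F (client r)
        (serverIterate η K F (fun i => client ⟨i % N, Nat.mod_lt i r.pos⟩) r) k)‖ ^ 2)
      / (∑ r : Fin N, (localSteps K r : ℝ)))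
    / (M : ℝ) ^ N

end DistOpt

end

/-! Upper bound. The local direction `v_k` starts at the exact gradient of `F` and is corrected by
differences of gradients of `F_m`, so its error changes by increments of `∇F_m - ∇F`, which is
`τ`-Lipschitz. Over at most `K` steps with `τηK ≤ 1/2` the accumulated error is absorbed by the
descent of each step (`sum_sq_norm_gradient_le_of_drift`). Since this holds for every choice of
clients, the descent telescopes along the run, no probability is needed, and the error is at most
`8(ΔH/(KN) + Δτ/N)` (`celsgdError_le`).

Lower bound. The objective is a chain: link `k` couples coordinate `k` to the preceding one through
a factor `β` that vanishes near zero. From a point supported on a prefix a gradient reveals at most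
one new coordinate, while the averaged gradient has norm at least `1/6` (before scaling) as long as
one coordinate is zero (`le_norm_chainGrad`). A chain of length `T`, with amplitude `a` of order
`Δ/T` and curvature scale `θ`, thus forces a squared gradient norm of order `Δθ/T` if the output
misses a coordinate. Three instances limit progress in different ways. `forces_heterogeneous`:
machines hold links of alternating parity, so each link costs a communication round and `T = R + 1`.
`forces_sequential`: all machines hold the same chain, and each round gives at most `K` links, so `T
= RK + 1`. `forces_stochastic`: the oracle hides the next link except with probability `p`; by
Markov's inequality fewer than `T` of the `MKR` calls succeed with probability at least `1/2`. The
hidden part has norm and Lipschitz constant independent of `T`, and smoothness is required only in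
first moment, so a small `p` does not spoil it.

Up to a constant the sum of the four terms is at most the largest of the three bounds. The instances
do not depend on the algorithm, so they bound the minimax error. For `σ = 0`, `R = 2N` and `Δτ ≤
H²ζ²` the two bounds match. -/

namespace DistOpt

/-! ### Convergence of CE-LSGD along an arbitrary sequence of clients -/

theorem descent_of_lipschitz_gradient {d : ℕ} {f : Vec d → ℝ} {H : ℝ} (hf : Differentiable ℝ f)
    (hs : ∀ x y, ‖gradient f x - gradient f y‖ ≤ H * ‖x - y‖) (x y : Vec d) :
    f y ≤ f x + inner ℝ (gradient f x) (y - x) + H / 2 * ‖y - x‖ ^ 2 := by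
  set v := y - x with hv
  have hline : ∀ t : ℝ, HasDerivAt (fun t : ℝ => x + t • v) v t := fun t => by
    simpa using ((hasDerivAt_id t).smul_const v).const_add x
  have hd : ∀ t : ℝ, HasDerivAt
      (fun t : ℝ => f (x + t • v) - t * inner ℝ (gradient f x) v - H / 2 * ‖v‖ ^ 2 * t ^ 2)
      (inner ℝ (gradient f (x + t • v)) v - inner ℝ (gradient f x) v - H * ‖v‖ ^ 2 * t) t := by
    intro t
    have h1 : HasDerivAt (fun t : ℝ => f (x + t • v)) (inner ℝ (gradient f (x + t • v)) v) t := by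
      have := (hf (x + t • v)).hasGradientAt.hasFDerivAt.comp_hasDerivAt t (hline t)
      exact this.congr_deriv (by simp)
    have h2 := (hasDerivAt_id t).mul_const (inner ℝ (gradient f x) v)
    have h3 := ((hasDerivAt_id t).pow 2).const_mul (H / 2 * ‖v‖ ^ 2)
    refine ((h1.sub h2).sub h3).congr_deriv ?_
    simp only [id, one_mul, mul_one, Nat.cast_ofNat, Nat.add_one_sub_one, pow_one]
    ring
  -- Along the segment, `f` minus its linear part and the quadratic `H/2 ‖v‖² t²` has nonpositive
  -- derivative, by Cauchy–Schwarz and the Lipschitz bound.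
  have hanti := antitoneOn_of_deriv_nonpos (convex_Icc (0 : ℝ) 1)
    (fun t _ => (hd t).continuousAt.continuousWithinAt)
    (fun t _ => (hd t).differentiableAt.differentiableWithinAt) (by
      intro t ht
      rw [interior_Icc] at ht
      rw [(hd t).deriv, ← inner_sub_left]
      have h1 := real_inner_le_norm (gradient f (x + t • v) - gradient f x) v
      have h2 := hs (x + t • v) x
      have h3 : ‖x + t • v - x‖ = t * ‖v‖ := by
        rw [add_sub_cancel_left, norm_smul, Real.norm_of_nonneg ht.1.le]
      rw [h3] at h2
      have := mul_le_mul_of_nonneg_right h2 (norm_nonneg v)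
      linarith [this, show H * (t * ‖v‖) * ‖v‖ = H * ‖v‖ ^ 2 * t by ring])
  have := hanti (Set.left_mem_Icc.2 zero_le_one) (Set.right_mem_Icc.2 zero_le_one) zero_le_one
  have hy : x + v = y := by rw [hv]; abel
  simp only [one_smul, hy, one_mul, one_pow, mul_one, zero_smul, add_zero, zero_mul, sub_zero, ne_eq,
    OfNat.ofNat_ne_zero, not_false_eq_true, zero_pow, mul_zero] at this
  linarith

theorem gradient_avg {M d : ℕ} {F : Fin M → Vec d → ℝ} (hF : ∀ m, Differentiable ℝ (F m))
    (x : Vec d) : HasGradientAt (avg F) ((M : ℝ)⁻¹ • ∑ n, gradient (F n) x) x := by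
  rw [hasGradientAt_iff_hasFDerivAt]
  have h := (HasFDerivAt.fun_sum (u := Finset.univ)
    (fun m _ => (hF m x).hasGradientAt.hasFDerivAt)).const_mul ((M : ℝ)⁻¹)
  have he : avg F = fun y => (M : ℝ)⁻¹ * ∑ m, F m y := by
    funext y; rw [avg, div_eq_inv_mul]
  rw [he]
  refine h.congr_fderiv ?_
  ext y
  simp

theorem norm_inv_smul_sum_le {M : ℕ} (hM : 0 < M) {E : Type*} [NormedAddCommGroup E]
    [NormedSpace ℝ E] (u : Fin M → E) {c : ℝ} (hu : ∀ m, ‖u m‖ ≤ c) :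
    ‖(M : ℝ)⁻¹ • ∑ m, u m‖ ≤ c := by
  have hM' : (0 : ℝ) < M := by exact_mod_cast hM
  rw [norm_smul, norm_inv, Real.norm_of_nonneg hM'.le, inv_mul_le_iff₀ hM']
  calc ‖∑ m, u m‖ ≤ ∑ _m : Fin M, c := norm_sum_le_of_le _ (fun m _ => hu m)
    _ = M * c := by simp

theorem InClass.gradient_avg_eq {M d : ℕ} {F : Fin M → Vec d → ℝ} {H Δ τ ζ : ℝ}
    (h : InClass F H Δ τ ζ) (x : Vec d) :
    gradient (avg F) x = (M : ℝ)⁻¹ • ∑ n, gradient (F n) x :=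
  (gradient_avg h.differentiable x).gradient

theorem InClass.avg_smooth {M d : ℕ} (hM : 0 < M) {F : Fin M → Vec d → ℝ} {H Δ τ ζ : ℝ}
    (h : InClass F H Δ τ ζ) (x y : Vec d) :
    ‖gradient (avg F) x - gradient (avg F) y‖ ≤ H * ‖x - y‖ := by
  rw [h.gradient_avg_eq, h.gradient_avg_eq, ← smul_sub, ← Finset.sum_sub_distrib]
  exact norm_inv_smul_sum_le hM _ (fun m => h.smooth m x y)

theorem InClass.gradient_sub_lipschitz {M d : ℕ} {F : Fin M → Vec d → ℝ} {H Δ τ ζ : ℝ}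
    (h : InClass F H Δ τ ζ) (m n : Fin M) (x y : Vec d) :
    ‖(gradient (F m) x - gradient (F n) x) - (gradient (F m) y - gradient (F n) y)‖
      ≤ τ * ‖x - y‖ := by
  have := Convex.norm_image_sub_le_of_norm_fderiv_le (𝕜 := ℝ) (s := Set.univ)
    (f := fun x => gradient (F m) x - gradient (F n) x) (C := τ) (x := y) (y := x)
    (fun z _ => ((h.twice_differentiable m).sub (h.twice_differentiable n)) z)
    (fun z _ => by
      rw [fderiv_fun_sub (h.twice_differentiable m z) (h.twice_differentiable n z)]
      exact h.second_order m n z) convex_univ (Set.mem_univ _) (Set.mem_univ _)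
  exact this

theorem InClass.gradient_sub_avg_lipschitz {M d : ℕ} (hM : 0 < M) {F : Fin M → Vec d → ℝ}
    {H Δ τ ζ : ℝ} (h : InClass F H Δ τ ζ) (m : Fin M) (x y : Vec d) :
    ‖(gradient (F m) x - gradient (avg F) x) - (gradient (F m) y - gradient (avg F) y)‖
      ≤ τ * ‖x - y‖ := by
  have hM' : (M : ℝ) ≠ 0 := by positivity
  have e : ∀ z, gradient (F m) z - gradient (avg F) z
      = (M : ℝ)⁻¹ • ∑ n, (gradient (F m) z - gradient (F n) z) := by
    intro z
    rw [h.gradient_avg_eq, Finset.sum_sub_distrib, smul_sub]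
    simp [← Nat.cast_smul_eq_nsmul ℝ, smul_smul, inv_mul_cancel₀ hM']
  rw [e, e, ← smul_sub, ← Finset.sum_sub_distrib]
  exact norm_inv_smul_sum_le hM _ (fun n => h.gradient_sub_lipschitz m n x y)

/-- Descent along steps `w_{k+1} = w_k - η v_k` whose directions `v_k` drift from the gradients by at
most `τ` times the distance travelled. -/
theorem sum_sq_norm_gradient_le_of_drift {E : Type*} [NormedAddCommGroup E]
    [InnerProductSpace ℝ E] {f : E → ℝ} {g : E → E} {H τ η : ℝ} {w v : ℕ → E} {Q : ℕ}
    (hη : 0 < η) (hτ : 0 ≤ τ) (hHη : H * η ≤ 1 / 2) (hτη : τ * η * Q ≤ 1 / 2)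
    (hdesc : ∀ x y, f y ≤ f x + inner ℝ (g x) (y - x) + H / 2 * ‖y - x‖ ^ 2)
    (hw1 : w 1 = w 0) (hv0 : v 0 = g (w 0)) (hw : ∀ k, w (k + 2) = w (k + 1) - η • v (k + 1))
    (hdrift : ∀ k, ‖(v (k + 1) - g (w (k + 1))) - (v k - g (w k))‖ ≤ τ * ‖w (k + 1) - w k‖) :
    η / 2 * ∑ k ∈ Finset.Icc 1 Q, ‖g (w k)‖ ^ 2 ≤ f (w 1) - f (w (Q + 1)) := by
  have hI : ∀ u : ℕ → ℝ, ∑ k ∈ Finset.Icc 1 Q, u k = ∑ k ∈ Finset.range Q, u (k + 1) := by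
    intro u
    rw [Finset.range_eq_Ico, Finset.sum_Ico_add' u 0 Q 1]
    rfl
  -- Since `w 1 = w 0` and `v 0` is exact, `v 1` is exact too; afterwards the error grows by `τ`
  -- times the step length `η‖v‖`.
  have herr : ∀ k, ‖v (k + 1) - g (w (k + 1))‖
      ≤ τ * η * ∑ j ∈ Finset.range k, ‖v (j + 1)‖ := by
    intro k
    induction k with
    | zero =>
      have h0 := hdrift 0
      simp only [zero_add, hw1, hv0, sub_self, sub_zero, norm_zero, mul_zero] at h0
      simpa [hw1] using h0
    | succ k ih =>
      have h0 := hdrift (k + 1)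
      have hs : ‖w (k + 1 + 1) - w (k + 1)‖ = η * ‖v (k + 1)‖ := by
        rw [hw k, sub_sub_cancel_left, norm_neg, norm_smul, Real.norm_of_nonneg hη.le]
      rw [hs] at h0
      rw [Finset.sum_range_succ, mul_add]
      have := norm_le_norm_add_norm_sub' (v (k + 1 + 1) - g (w (k + 1 + 1)))
        (v (k + 1) - g (w (k + 1)))
      linarith
  set V := ∑ k ∈ Finset.range Q, ‖v (k + 1)‖ ^ 2 with hV
  have hV0 : 0 ≤ V := Finset.sum_nonneg (fun _ _ => sq_nonneg _)
  have hQ0 : (0 : ℝ) ≤ Q := Nat.cast_nonneg Q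
  have herr2 : ∀ k ∈ Finset.range Q, ‖v (k + 1) - g (w (k + 1))‖ ^ 2 ≤ (τ * η) ^ 2 * (Q * V) := by
    intro k hk
    have h1 : ∑ j ∈ Finset.range k, ‖v (j + 1)‖ ≤ ∑ j ∈ Finset.range Q, ‖v (j + 1)‖ :=
      Finset.sum_le_sum_of_subset_of_nonneg
        (Finset.range_subset_range.2 (Finset.mem_range.1 hk).le) (fun _ _ _ => norm_nonneg _)
    have h2 := (herr k).trans (mul_le_mul_of_nonneg_left h1 (mul_nonneg hτ hη.le))
    have h3 := pow_le_pow_left₀ (norm_nonneg _) h2 2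
    have h4 : (∑ j ∈ Finset.range Q, ‖v (j + 1)‖) ^ 2 ≤ Q * V := by
      simpa using sq_sum_le_card_mul_sum_sq (s := Finset.range Q) (f := fun j => ‖v (j + 1)‖)
    rw [mul_pow] at h3
    exact h3.trans (mul_le_mul_of_nonneg_left h4 (sq_nonneg _))
  -- Cauchy–Schwarz gives the factor `(τηQ)²`, which is at most `1/4`: the errors sum to a fraction
  -- of `V`, and the term `η/4 ‖v‖²` in `hstep` pays for them.
  have herr3 : ∑ k ∈ Finset.range Q, ‖v (k + 1) - g (w (k + 1))‖ ^ 2 ≤ 1 / 4 * V := by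
    have h1 := Finset.sum_le_sum herr2
    rw [Finset.sum_const, Finset.card_range, nsmul_eq_mul] at h1
    have h2 : (τ * η * Q) ^ 2 ≤ (1 / 2) ^ 2 :=
      pow_le_pow_left₀ (by positivity) hτη 2
    have h3 := mul_le_mul_of_nonneg_right h2 hV0
    nlinarith
  -- Polarization turns `-η⟨g, v⟩` into `η/2 (‖v - g‖² - ‖g‖² - ‖v‖²)`; the quadratic term of the
  -- descent lemma uses up half of the `‖v‖²` gain because `Hη ≤ 1/2`.
  have hstep : ∀ k, η / 2 * ‖g (w (k + 1))‖ ^ 2 + η / 4 * ‖v (k + 1)‖ ^ 2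
      - η / 2 * ‖v (k + 1) - g (w (k + 1))‖ ^ 2 ≤ f (w (k + 1)) - f (w (k + 1 + 1)) := by
    intro k
    have h1 := hdesc (w (k + 1)) (w (k + 2))
    have hs : w (k + 2) - w (k + 1) = -(η • v (k + 1)) := by rw [hw k]; abel
    rw [hs, norm_neg, norm_smul, Real.norm_of_nonneg hη.le, inner_neg_right, inner_smul_right]
      at h1
    have h2 := norm_sub_sq_real (v (k + 1)) (g (w (k + 1)))
    rw [real_inner_comm] at h2
    have h3 : H / 2 * (η * ‖v (k + 1)‖) ^ 2 ≤ η / 4 * ‖v (k + 1)‖ ^ 2 := by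
      have := mul_le_mul_of_nonneg_right hHη (mul_nonneg hη.le (sq_nonneg ‖v (k + 1)‖))
      nlinarith
    have h4 : η / 2 * ‖v (k + 1) - g (w (k + 1))‖ ^ 2 = η / 2 * (‖v (k + 1)‖ ^ 2
      - 2 * inner ℝ (g (w (k + 1))) (v (k + 1)) + ‖g (w (k + 1))‖ ^ 2) := by rw [h2]
    rw [show k + 1 + 1 = k + 2 from rfl]
    linarith
  have hsum := Finset.sum_le_sum (s := Finset.range Q) (fun k _ => hstep k)
  rw [Finset.sum_range_sub' (fun k => f (w (k + 1))), Finset.sum_sub_distrib,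
    Finset.sum_add_distrib, ← Finset.mul_sum, ← Finset.mul_sum, ← Finset.mul_sum, ← hV] at hsum
  rw [hI]
  have h5 := mul_le_mul_of_nonneg_left herr3 (by positivity : (0 : ℝ) ≤ η / 2)
  have h6 : 0 ≤ η * V := mul_nonneg hη.le hV0
  simp only [zero_add] at hsum
  linarith

/-- The update of `v` uses gradients of the sampled `F m`, so the drift from the gradient of the
average is an increment of `∇F_m - ∇F`, controlled by `τ`. -/
theorem sum_sq_norm_gradient_localIterate_le {M d : ℕ} (hM : 0 < M) {F : Fin M → Vec d → ℝ}
    {H Δ τ ζ η : ℝ} (h : InClass F H Δ τ ζ) (hη : 0 < η) (hτ : 0 ≤ τ) (hHη : H * η ≤ 1 / 2)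
    {Q : ℕ} (hτη : τ * η * Q ≤ 1 / 2) (m : Fin M) (x : Vec d) :
    η / 2 * ∑ k ∈ Finset.Icc 1 Q, ‖gradient (avg F) (localIterate η F m x k)‖ ^ 2
      ≤ avg F x - avg F (localIterate η F m x (Q + 1)) := by
  set st := localPhase η (gradient (F m)) x ((M : ℝ)⁻¹ • ∑ n, gradient (F n) x) with hst
  have hw2 : ∀ k, (st (k + 1)).1 = (st k).2.1 := fun k => rfl
  have hdiff : Differentiable ℝ (avg F) :=
    fun x => (gradient_avg h.differentiable x).differentiableAt
  have := sum_sq_norm_gradient_le_of_drift (f := avg F) (g := gradient (avg F)) (H := H) (τ := τ)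
    (w := fun k => (st k).1) (v := fun k => (st k).2.2) (Q := Q) hη hτ hHη hτη
    (descent_of_lipschitz_gradient hdiff (h.avg_smooth hM)) rfl
    (h.gradient_avg_eq x).symm (fun k => rfl) (fun k => by
      refine le_trans (le_of_eq ?_) (h.gradient_sub_avg_lipschitz hM m (st (k + 1)).1 (st k).1)
      congr 1
      have e : (st (k + 1)).2.2 = (st k).2.2 + gradient (F m) (st (k + 1)).1
        - gradient (F m) (st k).1 := rfl
      rw [e]; abel)
  exact this

/-- Every iteration restarts from an exact gradient at the server iterate, so no error is carried
over and the decreases telescope for any sequence of clients. -/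
theorem sum_sq_norm_gradient_run_le {M d : ℕ} (hM : 0 < M) {F : Fin M → Vec d → ℝ}
    {H Δ τ ζ η : ℝ} (h : InClass F H Δ τ ζ) (hη : 0 < η) (hτ : 0 ≤ τ) (hHη : H * η ≤ 1 / 2)
    {K : ℕ} (hK : 1 ≤ K) (hτη : τ * η * K ≤ 1 / 2) (client : ℕ → Fin M) (N : ℕ) :
    η / 2 * ∑ r ∈ Finset.range N, ∑ k ∈ Finset.Icc 1 (localSteps K r),
      ‖gradient (avg F) (localIterate η F (client r) (serverIterate η K F client r) k)‖ ^ 2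
      ≤ avg F 0 - avg F (serverIterate η K F client N) := by
  induction N with
  | zero => simp [serverIterate]
  | succ N ih =>
    rw [Finset.sum_range_succ, mul_add]
    have hQ : localSteps K N ≤ K := by unfold localSteps; split_ifs <;> omega
    have hQ' : τ * η * localSteps K N ≤ 1 / 2 :=
      (mul_le_mul_of_nonneg_left (by exact_mod_cast hQ) (mul_nonneg hτ hη.le)).trans hτη
    have := sum_sq_norm_gradient_localIterate_le hM h hη hτ hHη hQ' (client N)
      (serverIterate η K F client N)
    rw [show serverIterate η K F client (N + 1) = localIterate η F (client N)
      (serverIterate η K F client N) (localSteps K N + 1) from rfl]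
    linarith

theorem sum_localSteps {K N : ℕ} (hN : 1 ≤ N) :
    ∑ r : Fin N, (localSteps K r : ℝ) = 1 + (N - 1) * K := by
  obtain ⟨n, rfl⟩ : ∃ n, N = n + 1 := ⟨N - 1, by omega⟩
  rw [Fin.sum_univ_succ]
  simp [localSteps]

theorem celsgdError_le {M d : ℕ} (hM : 0 < M) {F : Fin M → Vec d → ℝ} {H Δ τ ζ : ℝ}
    (h : InClass F H Δ τ ζ) (hH : 0 < H) (hΔ : 0 ≤ Δ) (hτ : 0 ≤ τ) {K N : ℕ} (hK : 1 ≤ K)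
    (hN : 2 ≤ N) :
    celsgdError (1 / 2 / max H (K * τ)) K N F ≤ 8 * (Δ * H / (K * N) + Δ * τ / N) := by
  set B := max H (K * τ) with hB
  have hB0 : 0 < B := lt_max_of_lt_left hH
  set η := 1 / 2 / B with hηd
  have hη : 0 < η := by positivity
  have hHη : H * η ≤ 1 / 2 := by
    have : H ≤ B := le_max_left _ _
    rw [hηd, mul_div_assoc', div_le_iff₀ hB0]; linarith
  have hτη : τ * η * K ≤ 1 / 2 := by
    have : K * τ ≤ B := le_max_right _ _
    rw [hηd, mul_div_assoc', div_mul_eq_mul_div, div_le_iff₀ hB0]; linarith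
  have hM' : (0 : ℝ) < M := by exact_mod_cast hM
  have hN' : (2 : ℝ) ≤ N := by exact_mod_cast hN
  have hK' : (1 : ℝ) ≤ K := by exact_mod_cast hK
  -- This is where `N ≥ 2` enters: the first iteration has one local step only, so the number of
  -- iterates is `1 + (N - 1)K`.
  have hS : N * K / 2 ≤ 1 + ((N : ℝ) - 1) * K := by nlinarith
  have hNK : (0 : ℝ) < N * K := by positivity
  have hbound : ∀ client : Fin N → Fin M, (∑ r : Fin N, ∑ k ∈ Finset.Icc 1 (localSteps K r),
      ‖gradient (avg F) (localIterate η F (client r)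
        (serverIterate η K F (fun i => client ⟨i % N, Nat.mod_lt i r.pos⟩) r) k)‖ ^ 2)
      / (∑ r : Fin N, (localSteps K r : ℝ)) ≤ 8 * (Δ * H / (K * N) + Δ * τ / N) := by
    intro client
    have hN0 : 0 < N := by omega
    have h1 := sum_sq_norm_gradient_run_le hM h hη hτ hHη hK hτη
      (fun i => client ⟨i % N, Nat.mod_lt i hN0⟩) N
    have h2 := h.subopt (serverIterate η K F (fun i => client ⟨i % N, Nat.mod_lt i hN0⟩) N)
    rw [← Fin.sum_univ_eq_sum_range] at h1
    -- The client sequence is extended periodically to all indices; the reduction modulo `N` does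
    -- nothing within the run.
    have h3 : ∀ r : Fin N, client ⟨(r : ℕ) % N, Nat.mod_lt _ hN0⟩ = client r := by
      intro r; congr 1; ext; exact Nat.mod_eq_of_lt r.isLt
    simp only [h3] at h1
    rw [sum_localSteps (by omega), div_le_iff₀ (lt_of_lt_of_le (by positivity) hS)]
    set S := ∑ r : Fin N, ∑ k ∈ Finset.Icc 1 (localSteps K r),
      ‖gradient (avg F) (localIterate η F (client r)
        (serverIterate η K F (fun i => client ⟨i % N, Nat.mod_lt i hN0⟩) r) k)‖ ^ 2
    have h4 : S ≤ 4 * Δ * B := by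
      have h5 : η / 2 * S ≤ Δ := h1.trans h2
      have h6 : η / 2 * (4 * B) = 1 := by rw [hηd]; field_simp; norm_num
      calc S = (η / 2 * (4 * B)) * S := by rw [h6, one_mul]
        _ = η / 2 * S * (4 * B) := by ring
        _ ≤ Δ * (4 * B) := mul_le_mul_of_nonneg_right h5 (by positivity)
        _ = 4 * Δ * B := by ring
    have h7 : B ≤ H + K * τ := max_le (by linarith [mul_nonneg (by positivity : (0 : ℝ) ≤ K) hτ])
      (by linarith)
    calc S ≤ 4 * Δ * B := h4
      _ ≤ 4 * Δ * (H + K * τ) := mul_le_mul_of_nonneg_left h7 (by positivity)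
      _ = 8 * (Δ * H / (K * N) + Δ * τ / N) * (N * K / 2) := by field_simp; ring
      _ ≤ _ := mul_le_mul_of_nonneg_left hS (by positivity)
  unfold celsgdError
  rw [div_le_iff₀ (by positivity)]
  refine (Finset.sum_le_sum fun c _ => hbound c).trans (le_of_eq ?_)
  rw [Finset.sum_const, Finset.card_univ, Fintype.card_fun, Fintype.card_fin, Fintype.card_fin,
    nsmul_eq_mul]
  push_cast; ring

/-! ### Profiles of the links of the hard instance -/

/-- The derivative of the smooth step is `C¹` with compact support, hence bounded and Lipschitz; `L`
serves for both. -/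
theorem exists_smooth_step : ∃ (ψ ψ' : ℝ → ℝ) (L : ℝ), 0 ≤ L ∧ (∀ u, HasDerivAt ψ (ψ' u) u) ∧
    Differentiable ℝ ψ' ∧ (∀ u, 0 ≤ ψ u) ∧ (∀ u, ψ u ≤ 1) ∧ (∀ u, u ≤ 1 / 2 → ψ u = 0) ∧
    (∀ u, 1 ≤ u → ψ u = 1) ∧ (∀ u, 0 ≤ ψ' u) ∧ (∀ u, ψ' u ≤ L) ∧ ψ' 0 = 0 ∧
    (∀ u v, |ψ' u - ψ' v| ≤ L * |u - v|) := by
  set ψ : ℝ → ℝ := fun u => Real.smoothTransition (2 * u - 1) with hψ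
  have hc : ContDiff ℝ 2 ψ := by
    have := Real.smoothTransition.contDiff (n := 2)
    exact this.comp (by fun_prop)
  have hmono : Monotone ψ := fun u v h => Real.smoothTransition.monotone (by linarith)
  have h0 : ∀ u, u ≤ 1 / 2 → ψ u = 0 := fun u h =>
    Real.smoothTransition.zero_of_nonpos (by linarith)
  have h1 : ∀ u, 1 ≤ u → ψ u = 1 := fun u h => Real.smoothTransition.one_of_one_le (by linarith)
  have hd0 : ∀ u, u < 1 / 2 → deriv ψ u = 0 := by
    intro u hu
    have : ψ =ᶠ[nhds u] fun _ => 0 := by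
      filter_upwards [Iio_mem_nhds hu] with v hv using h0 v (le_of_lt hv)
    rw [this.deriv_eq]; simp
  have hd1 : ∀ u, 1 < u → deriv ψ u = 0 := by
    intro u hu
    have : ψ =ᶠ[nhds u] fun _ => 1 := by
      filter_upwards [Ioi_mem_nhds hu] with v hv using h1 v (le_of_lt hv)
    rw [this.deriv_eq]; simp
  have hcs : HasCompactSupport (deriv ψ) := by
    refine HasCompactSupport.intro (isCompact_Icc (a := (0 : ℝ)) (b := 1)) fun u hu => ?_
    by_cases h : u < 1 / 2
    · exact hd0 u h
    · refine hd1 u (lt_of_not_ge fun h' => hu ⟨by linarith [not_lt.1 h], h'⟩)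
  have hc1 : ContDiff ℝ 1 (deriv ψ) := by
    have := (contDiff_succ_iff_deriv (n := 1) (f := ψ)).1 (by rw [one_add_one_eq_two]; exact hc)
    exact this.2.2
  obtain ⟨C, hC⟩ := hcs.exists_bound_of_continuous hc1.continuous
  obtain ⟨C', hC'⟩ := ContDiff.lipschitzWith_of_hasCompactSupport hcs hc1 one_ne_zero
  refine ⟨ψ, deriv ψ, max C C', le_max_of_le_right C'.2,
    fun u => (hc.differentiable (by norm_num) u).hasDerivAt, hc1.differentiable (by norm_num),
    fun u => Real.smoothTransition.nonneg _, fun u => Real.smoothTransition.le_one _, h0, h1,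
    fun u => hmono.deriv_nonneg, fun u => ?_, hd0 0 (by norm_num), fun u v => ?_⟩
  · exact ((le_abs_self _).trans (hC u)).trans (le_max_left _ _)
  · have := hC'.dist_le_mul u v
    rw [Real.dist_eq, Real.dist_eq] at this
    exact this.trans (mul_le_mul_of_nonneg_right (le_max_right _ _) (abs_nonneg _))

/-- The scalar functions from which the links of the hard chain are built, with their derivatives
`α'`, `β'`, `γ'` and a constant `L` which bounds derivatives and Lipschitz constants. -/
structure Profile where
  α : ℝ → ℝ
  α' : ℝ → ℝ
  β : ℝ → ℝ
  β' : ℝ → ℝ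
  γ : ℝ → ℝ
  γ' : ℝ → ℝ
  L : ℝ
  two_le_L : 2 ≤ L
  hasDerivAt_α : ∀ u, HasDerivAt α (α' u) u
  hasDerivAt_β : ∀ u, HasDerivAt β (β' u) u
  hasDerivAt_γ : ∀ u, HasDerivAt γ (γ' u) u
  differentiable_α' : Differentiable ℝ α'
  differentiable_β' : Differentiable ℝ β'
  differentiable_γ' : Differentiable ℝ γ'
  abs_α_le : ∀ u, |α u| ≤ 2
  β_nonneg : ∀ u, 0 ≤ β u
  β_le_one : ∀ u, β u ≤ 1
  abs_γ_le : ∀ u, |γ u| ≤ 2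
  β_eq_zero : ∀ u, |u| ≤ 1 / 2 → β u = 0
  β_eq_one : ∀ u, 1 ≤ |u| → β u = 1
  γ_zero : γ 0 = 0
  γ'_zero : γ' 0 = 1
  α'_zero : α' 0 = 0
  β'_zero : β' 0 = 0
  γ'_nonneg : ∀ u, 0 ≤ γ' u
  γ'_le_one : ∀ u, γ' u ≤ 1
  half_le_γ' : ∀ u, |u| ≤ 1 → 1 / 2 ≤ γ' u
  abs_β'_le : ∀ u, 2 * |β' u| ≤ α' u
  α'_le : ∀ u, α' u ≤ L
  α'_lip : ∀ u v, |α' u - α' v| ≤ L * |u - v|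
  β'_lip : ∀ u v, |β' u - β' v| ≤ L * |u - v|
  γ'_lip : ∀ u v, |γ' u - γ' v| ≤ |u - v|

theorem inv_one_add_sq_lip (u v : ℝ) :
    |(1 + u ^ 2)⁻¹ - (1 + v ^ 2)⁻¹| ≤ |u - v| := by
  have hu : 0 < 1 + u ^ 2 := by positivity
  have hv : 0 < 1 + v ^ 2 := by positivity
  have e : (1 + u ^ 2)⁻¹ - (1 + v ^ 2)⁻¹ = (v - u) * (u + v) / ((1 + u ^ 2) * (1 + v ^ 2)) := by
    field_simp; ring
  rw [e, abs_div, abs_mul, abs_of_pos (mul_pos hu hv), div_le_iff₀ (mul_pos hu hv),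
    abs_sub_comm v u]
  refine mul_le_mul_of_nonneg_left ?_ (abs_nonneg _)
  rw [abs_le]
  constructor <;> nlinarith [sq_nonneg (u - 1), sq_nonneg (v - 1), sq_nonneg (u + 1),
    sq_nonneg (v + 1), sq_nonneg (u * v)]

/-- With a step `ψ`, take `α` as twice the odd and `β` as the even combination of `ψ(u)` and
`ψ(-u)`: as `ψ' ≥ 0`, the triangle inequality gives `2|β'| ≤ α'`. The role of `γ` is played by
`arctan`, whose values stay below `π/2 ≤ 2`. -/
theorem exists_profile : Nonempty Profile := by
  obtain ⟨ψ, ψ', L, hL, hd, hdd, h0, h1, hz, ho, h0', hL', hz', hlip⟩ := exists_smooth_step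
  have hdn : ∀ u, HasDerivAt (fun u => ψ (-u)) (-ψ' (-u)) u := fun u => by
    have := (hd (-u)).comp u (hasDerivAt_neg u)
    exact this.congr_deriv (by ring)
  have hddn : Differentiable ℝ (fun u => ψ' (-u)) := hdd.comp differentiable_neg
  have hlipn : ∀ u v, |ψ' (-u) - ψ' (-v)| ≤ L * |u - v| := fun u v => by
    have := hlip (-u) (-v)
    rwa [show -u - -v = -(u - v) by ring, abs_neg] at this
  have hsep : ∀ u, ψ u = 0 ∨ ψ (-u) = 0 := fun u => by
    rcases le_total u 0 with h | h
    · exact Or.inl (hz _ (by linarith))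
    · exact Or.inr (hz _ (by linarith))
  refine ⟨{
    α := fun u => 2 * (ψ u - ψ (-u))
    α' := fun u => 2 * (ψ' u + ψ' (-u))
    β := fun u => ψ u + ψ (-u)
    β' := fun u => ψ' u - ψ' (-u)
    γ := Real.arctan
    γ' := fun u => (1 + u ^ 2)⁻¹
    L := 4 * L + 2
    two_le_L := by linarith
    hasDerivAt_α := fun u => (((hd u).sub (hdn u)).const_mul 2).congr_deriv (by ring)
    hasDerivAt_β := fun u => ((hd u).add (hdn u)).congr_deriv (by ring)
    hasDerivAt_γ := Real.hasDerivAt_arctan'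
    differentiable_α' := (hdd.add hddn).const_mul 2
    differentiable_β' := hdd.sub hddn
    differentiable_γ' := fun u => by
      have : (1 + u ^ 2) ≠ 0 := by positivity
      fun_prop (disch := exact this)
    abs_α_le := fun u => by
      rw [abs_le]; constructor <;> linarith [h0 u, h0 (-u), h1 u, h1 (-u)]
    β_nonneg := fun u => add_nonneg (h0 _) (h0 _)
    β_le_one := fun u => by rcases hsep u with h | h <;> rw [h] <;> linarith [h1 u, h1 (-u)]
    abs_γ_le := fun u => by
      have h1 := Real.arctan_lt_pi_div_two u
      have h2 := Real.neg_pi_div_two_lt_arctan u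
      have h3 := Real.pi_le_four
      rw [abs_le]; constructor <;> linarith
    β_eq_zero := fun u h => by
      rw [abs_le] at h
      rw [hz u h.2, hz (-u) (by linarith), add_zero]
    β_eq_one := fun u h => by
      rcases le_abs.1 h with h' | h'
      · rw [ho u h', hz (-u) (by linarith), add_zero]
      · rw [ho (-u) h', hz u (by linarith), zero_add]
    γ_zero := Real.arctan_zero
    γ'_zero := by norm_num
    α'_zero := by simp [hz']
    β'_zero := by simp
    γ'_nonneg := fun u => by positivity
    γ'_le_one := fun u => inv_le_one_of_one_le₀ (by nlinarith [sq_nonneg u])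
    half_le_γ' := fun u h => by
      have : u ^ 2 ≤ 1 := (sq_le_one_iff_abs_le_one u).2 h
      rw [one_div]
      exact inv_anti₀ (by positivity) (by linarith)
    abs_β'_le := fun u => by
      have : |ψ' u - ψ' (-u)| ≤ ψ' u + ψ' (-u) := by
        rw [abs_le]; constructor <;> linarith [h0' u, h0' (-u)]
      linarith
    α'_le := fun u => by linarith [hL' u, hL' (-u)]
    α'_lip := fun u v => by
      have h := hlip u v
      have h' := hlipn u v
      have hp := abs_nonneg (u - v)
      rw [abs_le] at h h' ⊢
      constructor <;> linarith
    β'_lip := fun u v => by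
      have h := hlip u v
      have h' := hlipn u v
      have hp := abs_nonneg (u - v)
      have hq := mul_nonneg hL hp
      rw [abs_le] at h h' ⊢
      constructor <;> linarith
    γ'_lip := inv_one_add_sq_lip }⟩

namespace Profile

variable (P : Profile)

theorem L_pos : 0 < P.L := by linarith [P.two_le_L]

theorem α'_nonneg (u : ℝ) : 0 ≤ P.α' u :=
  le_trans (by positivity) (P.abs_β'_le u)

theorem two_mul_abs_β'_le (u : ℝ) : 2 * |P.β' u| ≤ P.L := (P.abs_β'_le u).trans (P.α'_le u)

theorem β_lip (u v : ℝ) : |P.β u - P.β v| ≤ P.L * |u - v| := by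
  refine Convex.norm_image_sub_le_of_norm_hasDerivWithin_le (s := Set.univ)
    (fun x _ => (P.hasDerivAt_β x).hasDerivWithinAt) (fun x _ => ?_) convex_univ
    (Set.mem_univ v) (Set.mem_univ u)
  rw [Real.norm_eq_abs]
  linarith [P.two_mul_abs_β'_le x, abs_nonneg (P.β' x)]

theorem γ_lip (u v : ℝ) : |P.γ u - P.γ v| ≤ |u - v| := by
  have := Convex.norm_image_sub_le_of_norm_hasDerivWithin_le (s := Set.univ) (C := 1)
    (fun x _ => (P.hasDerivAt_γ x).hasDerivWithinAt) (fun x _ => by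
      rw [Real.norm_eq_abs, abs_of_nonneg (P.γ'_nonneg x)]; exact P.γ'_le_one x) convex_univ
    (Set.mem_univ v) (Set.mem_univ u)
  simpa using this

end Profile

/-! ### The hard chain -/

/-- The coordinate `k` of `x`, or `0` if there is no such coordinate. -/
noncomputable def coord {T : ℕ} (x : Vec T) (k : ℕ) : ℝ := if h : k < T then x ⟨k, h⟩ else 0

/-- `coord` as a linear functional. -/
noncomputable def coordL (T k : ℕ) : Vec T →L[ℝ] ℝ :=
  if h : k < T then EuclideanSpace.proj ⟨k, h⟩ else 0

theorem coordL_apply {T : ℕ} (k : ℕ) (x : Vec T) : coordL T k x = coord x k := by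
  unfold coordL coord; split_ifs <;> simp

@[simp] theorem coord_fin {T : ℕ} (x : Vec T) (i : Fin T) : coord x i = x i := by simp [coord]

theorem coord_sub {T : ℕ} (x y : Vec T) (k : ℕ) : coord (x - y) k = coord x k - coord y k := by
  simp only [← coordL_apply, map_sub]

theorem hasFDerivAt_coord {T : ℕ} (k : ℕ) (x : Vec T) :
    HasFDerivAt (fun x => coord x k) (coordL T k) x := by
  have h := (coordL T k).hasFDerivAt (x := x)
  rwa [show ⇑(coordL T k) = fun x => coord x k from funext (coordL_apply k)] at h

theorem differentiable_coord {T : ℕ} (k : ℕ) : Differentiable ℝ (fun x : Vec T => coord x k) :=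
  fun x => (hasFDerivAt_coord k x).differentiableAt

theorem sum_coord_sq {T : ℕ} (x : Vec T) : ∑ k ∈ Finset.range T, coord x k ^ 2 = ‖x‖ ^ 2 := by
  rw [← Fin.sum_univ_eq_sum_range (fun k => coord x k ^ 2), EuclideanSpace.real_norm_sq_eq]
  simp

theorem abs_apply_le_norm {T : ℕ} (x : Vec T) (i : Fin T) : |x i| ≤ ‖x‖ :=
  PiLp.norm_apply_le x i

/-- The coordinate before coordinate `k`, or `0` if there is none. -/
noncomputable def prevCoord {T : ℕ} (x : Vec T) : ℕ → ℝ
  | 0 => 0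
  | k + 1 => coord x k

/-- A vector whose entries are bounded by three neighbouring entries of another one. -/
theorem norm_le_of_abs_apply_le {T : ℕ} {u δ : Vec T} {C : ℝ} (hC : 0 ≤ C)
    (h : ∀ i : Fin T, |u i| ≤ C * (|prevCoord δ i| + |coord δ i| + |coord δ (i + 1)|)) :
    ‖u‖ ≤ 3 * C * ‖δ‖ := by
  refine le_of_sq_le_sq ?_ (by positivity)
  have h1 : ∀ i : Fin T, u i ^ 2
      ≤ 3 * C ^ 2 * (prevCoord δ i ^ 2 + coord δ i ^ 2 + coord δ (i + 1) ^ 2) := by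
    intro i
    have h2 := pow_le_pow_left₀ (abs_nonneg _) (h i) 2
    rw [sq_abs, mul_pow] at h2
    refine h2.trans ?_
    rw [← sq_abs (prevCoord δ i), ← sq_abs (coord δ i), ← sq_abs (coord δ (i + 1))]
    set a := |prevCoord δ i|
    set b := |coord δ i|
    set c := |coord δ (i + 1)|
    have : (a + b + c) ^ 2 ≤ 3 * (a ^ 2 + b ^ 2 + c ^ 2) := by
      nlinarith [sq_nonneg (a - b), sq_nonneg (b - c), sq_nonneg (a - c)]
    calc C ^ 2 * (a + b + c) ^ 2 ≤ C ^ 2 * (3 * (a ^ 2 + b ^ 2 + c ^ 2)) :=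
          mul_le_mul_of_nonneg_left this (sq_nonneg C)
      _ = _ := by ring
  have hp : ∑ k ∈ Finset.range T, prevCoord δ k ^ 2 ≤ ‖δ‖ ^ 2 := by
    rw [← sum_coord_sq]
    cases T with
    | zero => simp
    | succ n =>
      rw [Finset.sum_range_succ', Finset.sum_range_succ _ n]
      simp only [prevCoord]
      have := sq_nonneg (coord δ n)
      linarith
  have hn : ∑ k ∈ Finset.range T, coord δ (k + 1) ^ 2 ≤ ‖δ‖ ^ 2 := by
    have e1 := Finset.sum_range_succ' (fun k => coord δ k ^ 2) T
    rw [Finset.sum_range_succ, sum_coord_sq] at e1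
    have e2 : coord δ T = 0 := by simp [coord]
    rw [e2] at e1
    have := sq_nonneg (coord δ 0)
    linarith
  rw [EuclideanSpace.real_norm_sq_eq]
  refine (Finset.sum_le_sum fun i _ => h1 i).trans ?_
  rw [← Finset.mul_sum, Finset.sum_add_distrib, Finset.sum_add_distrib,
    Fin.sum_univ_eq_sum_range (fun k => prevCoord δ k ^ 2),
    Fin.sum_univ_eq_sum_range (fun k => coord δ k ^ 2),
    Fin.sum_univ_eq_sum_range (fun k => coord δ (k + 1) ^ 2), sum_coord_sq]
  have : 3 * C ^ 2 * (∑ k ∈ Finset.range T, prevCoord δ k ^ 2 + ‖δ‖ ^ 2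
      + ∑ k ∈ Finset.range T, coord δ (k + 1) ^ 2) ≤ 3 * C ^ 2 * (‖δ‖ ^ 2 + ‖δ‖ ^ 2 + ‖δ‖ ^ 2) := by
    gcongr
  refine this.trans (le_of_eq (by ring))

namespace Profile

variable (P : Profile) {T : ℕ}

/-- The factor of link `k` that depends on the preceding coordinate. -/
noncomputable def lead (x : Vec T) : ℕ → ℝ
  | 0 => 1
  | k + 1 => P.β (coord x k)

theorem lead_nonneg (x : Vec T) (k : ℕ) : 0 ≤ P.lead x k := by
  cases k with
  | zero => exact zero_le_one
  | succ k => exact P.β_nonneg _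

theorem lead_le_one (x : Vec T) (k : ℕ) : P.lead x k ≤ 1 := by
  cases k with
  | zero => exact le_rfl
  | succ k => exact P.β_le_one _

theorem lead_lip (x y : Vec T) (k : ℕ) :
    |P.lead x k - P.lead y k| ≤ P.L * |prevCoord (x - y) k| := by
  cases k with
  | zero => simp [lead, prevCoord]
  | succ k => simpa [lead, prevCoord, coord_sub] using P.β_lip (coord x k) (coord y k)

theorem differentiable_lead (k : ℕ) : Differentiable ℝ (fun x : Vec T => P.lead x k) := by
  cases k with
  | zero => exact differentiable_const _
  | succ k =>
    exact fun x => (P.hasDerivAt_β _).differentiableAt.comp x (differentiable_coord k x)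

/-- The hard chain; `w k` is the weight of its link `k`. -/
noncomputable def chain (s : ℝ) (w : ℕ → ℝ) (x : Vec T) : ℝ :=
  -∑ k ∈ Finset.range T, (s * P.α (coord x k) + w k * (P.lead x k * P.γ (coord x k)))

/-- The gradient of the hard chain. -/
noncomputable def chainGrad (s : ℝ) (w : ℕ → ℝ) (x : Vec T) : Vec T :=
  WithLp.toLp 2 fun i => -(s * P.α' (x i) + w (i + 1) * (P.β' (x i) * P.γ (coord x (i + 1)))
    + w i * (P.lead x i * P.γ' (x i)))

theorem chainGrad_apply (s : ℝ) (w : ℕ → ℝ) (x : Vec T) (i : Fin T) :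
    P.chainGrad s w x i = -(s * P.α' (x i) + w (i + 1) * (P.β' (x i) * P.γ (coord x (i + 1)))
      + w i * (P.lead x i * P.γ' (x i))) := rfl

/-- The derivative of `lead`. -/
noncomputable def leadL (x : Vec T) : ℕ → (Vec T →L[ℝ] ℝ)
  | 0 => 0
  | k + 1 => P.β' (coord x k) • coordL T k

theorem hasFDerivAt_lead (x : Vec T) (k : ℕ) :
    HasFDerivAt (fun x => P.lead x k) (P.leadL x k) x := by
  cases k with
  | zero => exact hasFDerivAt_const _ _
  | succ k => exact (P.hasDerivAt_β _).comp_hasFDerivAt x (hasFDerivAt_coord k x)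

theorem hasGradientAt_chain (s : ℝ) (w : ℕ → ℝ) (x : Vec T) :
    HasGradientAt (P.chain s w) (P.chainGrad s w x) x := by
  rw [hasGradientAt_iff_hasFDerivAt]
  have h1 : ∀ k ∈ Finset.range T, HasFDerivAt
      (fun x : Vec T => s * P.α (coord x k) + w k * (P.lead x k * P.γ (coord x k)))
      (s • (P.α' (coord x k) • coordL T k)
        + w k • (P.lead x k • (P.γ' (coord x k) • coordL T k)
        + P.γ (coord x k) • P.leadL x k)) x := fun k _ =>
    (((P.hasDerivAt_α _).comp_hasFDerivAt x (hasFDerivAt_coord k x)).const_mul s).add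
      (((P.hasFDerivAt_lead x k).mul
        ((P.hasDerivAt_γ _).comp_hasFDerivAt x (hasFDerivAt_coord k x))).const_mul (w k))
  have h2 := (HasFDerivAt.fun_sum h1).neg
  refine h2.congr_fderiv ?_
  ext v
  have e1 : inner ℝ (P.chainGrad s w x) v = ∑ k ∈ Finset.range T,
      -(s * P.α' (coord x k) + w (k + 1) * (P.β' (coord x k) * P.γ (coord x (k + 1)))
        + w k * (P.lead x k * P.γ' (coord x k))) * coord v k := by
    rw [PiLp.inner_apply, ← Fin.sum_univ_eq_sum_range (fun k =>
      -(s * P.α' (coord x k) + w (k + 1) * (P.β' (coord x k) * P.γ (coord x (k + 1)))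
        + w k * (P.lead x k * P.γ' (coord x k))) * coord v k)]
    refine Finset.sum_congr rfl fun i _ => ?_
    simp [chainGrad_apply, mul_comm]
  -- Summation by shift: the factor `β(x_k)` of link `k + 1` contributes to coordinate `k`. Both
  -- boundary terms vanish, as link `0` has a constant factor and `coord x T = 0` with `γ 0 = 0`.
  have e2 : ∑ k ∈ Finset.range T, w k * (P.γ (coord x k) * P.leadL x k v)
      = ∑ k ∈ Finset.range T,
        w (k + 1) * (P.γ (coord x (k + 1)) * (P.β' (coord x k) * coord v k)) := by
    have := (Finset.sum_range_succ (fun k => w k * (P.γ (coord x k) * P.leadL x k v)) T).symm.trans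
      (Finset.sum_range_succ' (fun k => w k * (P.γ (coord x k) * P.leadL x k v)) T)
    have e3 : coord x T = 0 := by simp [coord]
    simp only [e3, P.γ_zero, leadL, zero_mul, mul_zero, add_zero,
      zero_apply, smul_apply, coordL_apply,
      smul_eq_mul] at this
    exact this
  rw [InnerProductSpace.toDual_apply_apply, e1]
  simp only [neg_apply, sum_apply,
    add_apply, smul_apply, smul_eq_mul, coordL_apply,
    mul_add, Finset.sum_add_distrib, e2]
  rw [← Finset.sum_add_distrib, ← Finset.sum_add_distrib, ← Finset.sum_neg_distrib]
  refine Finset.sum_congr rfl fun k _ => ?_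
  ring

theorem differentiable_chainGrad (s : ℝ) (w : ℕ → ℝ) :
    Differentiable ℝ (P.chainGrad s w : Vec T → Vec T) := by
  rw [differentiable_euclidean]
  intro i
  simp only [chainGrad_apply]
  have hi : Differentiable ℝ (fun x : Vec T => x i) := by
    simpa using differentiable_coord (T := T) (i : ℕ)
  have hγ : Differentiable ℝ P.γ := fun u => (P.hasDerivAt_γ u).differentiableAt
  exact ((((P.differentiable_α'.comp hi).const_mul s).add
    (((P.differentiable_β'.comp hi).mul (hγ.comp (differentiable_coord _))).const_mul _)).add
    (((P.differentiable_lead _).mul (P.differentiable_γ'.comp hi)).const_mul _)).neg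

/-- Each gradient entry involves only three neighbouring coordinates, so the constant does not
depend on `T`. -/
theorem chainGrad_lip {s : ℝ} {w : ℕ → ℝ} (hs : |s| ≤ 1) (hw : ∀ k, |w k| ≤ 1) (x y : Vec T) :
    ‖P.chainGrad s w x - P.chainGrad s w y‖ ≤ 12 * P.L * ‖x - y‖ := by
  have hL := P.L_pos
  rw [show 12 * P.L = 3 * (4 * P.L) by ring]
  refine norm_le_of_abs_apply_le (by positivity) fun i => ?_
  rw [coord_fin]
  set a := |prevCoord (x - y) i| with ha
  set b := |(x - y) i| with hb
  set c := |coord (x - y) (i + 1)| with hc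
  have hb' : |x i - y i| = b := rfl
  have hc' : |coord x (i + 1) - coord y (i + 1)| = c := by rw [hc, coord_sub]
  have ha0 : 0 ≤ a := abs_nonneg _
  have hb0 : 0 ≤ b := abs_nonneg _
  have hc0 : 0 ≤ c := abs_nonneg _
  have key : ∀ {t u B : ℝ}, |t| ≤ 1 → |u| ≤ B → |t * u| ≤ B := fun {t u B} ht hu => by
    rw [abs_mul]
    calc |t| * |u| ≤ 1 * |u| := mul_le_mul_of_nonneg_right ht (abs_nonneg _)
      _ ≤ B := by linarith
  have h1 : |P.α' (x i) - P.α' (y i)| ≤ P.L * b := P.α'_lip _ _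
  have h2 : |P.β' (x i) * P.γ (coord x (i + 1)) - P.β' (y i) * P.γ (coord y (i + 1))|
      ≤ 2 * P.L * b + P.L * c := by
    rw [show P.β' (x i) * P.γ (coord x (i + 1)) - P.β' (y i) * P.γ (coord y (i + 1))
      = (P.β' (x i) - P.β' (y i)) * P.γ (coord x (i + 1))
        + P.β' (y i) * (P.γ (coord x (i + 1)) - P.γ (coord y (i + 1))) by ring]
    refine (abs_add_le _ _).trans (add_le_add ?_ ?_)
    · rw [abs_mul]
      calc |P.β' (x i) - P.β' (y i)| * |P.γ (coord x (i + 1))| ≤ (P.L * b) * 2 :=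
            mul_le_mul (P.β'_lip _ _) (P.abs_γ_le _) (abs_nonneg _) (by positivity)
        _ = 2 * P.L * b := by ring
    · rw [abs_mul]
      refine mul_le_mul ?_ ((P.γ_lip _ _).trans hc'.le) (abs_nonneg _) hL.le
      linarith [P.two_mul_abs_β'_le (y i), abs_nonneg (P.β' (y i))]
  have h3 : |P.lead x i * P.γ' (x i) - P.lead y i * P.γ' (y i)| ≤ P.L * a + b := by
    rw [show P.lead x i * P.γ' (x i) - P.lead y i * P.γ' (y i)
      = (P.lead x i - P.lead y i) * P.γ' (x i) + P.lead y i * (P.γ' (x i) - P.γ' (y i)) by ring]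
    refine (abs_add_le _ _).trans (add_le_add ?_ ?_)
    · rw [abs_mul, abs_of_nonneg (P.γ'_nonneg _)]
      calc |P.lead x i - P.lead y i| * P.γ' (x i) ≤ (P.L * a) * 1 :=
            mul_le_mul (P.lead_lip _ _ _) (P.γ'_le_one _) (P.γ'_nonneg _) (by positivity)
        _ = P.L * a := by ring
    · refine key ?_ (P.γ'_lip _ _)
      rw [abs_of_nonneg (P.lead_nonneg _ _)]
      exact P.lead_le_one _ _
  have e : (P.chainGrad s w x - P.chainGrad s w y) i = -(s * (P.α' (x i) - P.α' (y i))
      + w (i + 1) * (P.β' (x i) * P.γ (coord x (i + 1)) - P.β' (y i) * P.γ (coord y (i + 1)))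
      + w i * (P.lead x i * P.γ' (x i) - P.lead y i * P.γ' (y i))) := by
    rw [PiLp.sub_apply, chainGrad_apply, chainGrad_apply]; ring
  rw [e, abs_neg]
  refine (abs_add_three _ _ _).trans ?_
  have g1 := key hs h1
  have g2 := key (hw (i + 1)) h2
  have g3 := key (hw i) h3
  have : b ≤ P.L * b := by nlinarith [P.two_le_L]
  nlinarith [mul_nonneg hL.le ha0, mul_nonneg hL.le hb0, mul_nonneg hL.le hc0]

/-- The factor `T` cancels against the `1/T` in `(aμ)²` from `exists_scale`, so first-order
heterogeneity does not grow with the length of the chain. -/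
theorem norm_chainGrad_sq_le {s : ℝ} {w : ℕ → ℝ} (hs : |s| ≤ 1) (hw : ∀ k, |w k| ≤ 1)
    (x : Vec T) : ‖P.chainGrad s w x‖ ^ 2 ≤ 9 * P.L ^ 2 * T := by
  have hL := P.L_pos
  have key : ∀ {t u B : ℝ}, |t| ≤ 1 → |u| ≤ B → |t * u| ≤ B := fun {t u B} ht hu => by
    rw [abs_mul]
    calc |t| * |u| ≤ 1 * |u| := mul_le_mul_of_nonneg_right ht (abs_nonneg _)
      _ ≤ B := by linarith
  have h : ∀ i : Fin T, P.chainGrad s w x i ^ 2 ≤ 9 * P.L ^ 2 := by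
    intro i
    rw [show 9 * P.L ^ 2 = (3 * P.L) ^ 2 by ring, ← sq_abs]
    refine pow_le_pow_left₀ (abs_nonneg _) ?_ 2
    rw [chainGrad_apply, abs_neg]
    refine (abs_add_three _ _ _).trans ?_
    have g1 : |s * P.α' (x i)| ≤ P.L :=
      key hs (by rw [abs_of_nonneg (P.α'_nonneg _)]; exact P.α'_le _)
    have g2 : |w (i + 1) * (P.β' (x i) * P.γ (coord x (i + 1)))| ≤ P.L := by
      refine key (hw _) ?_
      rw [abs_mul]
      calc |P.β' (x i)| * |P.γ (coord x (i + 1))| ≤ |P.β' (x i)| * 2 :=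
            mul_le_mul_of_nonneg_left (P.abs_γ_le _) (abs_nonneg _)
        _ ≤ P.L := by linarith [P.two_mul_abs_β'_le (x i)]
    have g3 : |w i * (P.lead x i * P.γ' (x i))| ≤ 1 := by
      refine key (hw _) ?_
      rw [abs_of_nonneg (mul_nonneg (P.lead_nonneg _ _) (P.γ'_nonneg _))]
      exact mul_le_one₀ (P.lead_le_one _ _) (P.γ'_nonneg _) (P.γ'_le_one _)
    linarith [P.two_le_L]
  rw [EuclideanSpace.real_norm_sq_eq]
  refine (Finset.sum_le_sum fun i _ => h i).trans (le_of_eq ?_)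
  simp; ring

theorem abs_chain_le {s : ℝ} {w : ℕ → ℝ} (hs : |s| ≤ 1) (hw : ∀ k, |w k| ≤ 1) (x : Vec T) :
    |P.chain s w x| ≤ 4 * T := by
  unfold chain
  rw [abs_neg]
  refine (Finset.abs_sum_le_sum_abs _ _).trans ?_
  refine (Finset.sum_le_sum (g := fun _ => (4 : ℝ)) fun k _ => ?_).trans (le_of_eq (by
    simp [mul_comm]))
  refine (abs_add_le _ _).trans ?_
  rw [abs_mul, abs_mul, abs_mul, abs_of_nonneg (P.lead_nonneg x k)]
  have h1 := mul_le_mul hs (P.abs_α_le (coord x k)) (abs_nonneg _) zero_le_one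
  have h2 := mul_le_mul (P.lead_le_one x k) (P.abs_γ_le (coord x k)) (abs_nonneg _) zero_le_one
  have h3 := mul_le_mul (hw k) h2 (mul_nonneg (P.lead_nonneg x k) (abs_nonneg _)) zero_le_one
  linarith

/-- Progress-free points have large gradients: the gradient of the chain is large wherever the last
coordinate vanishes. -/
theorem le_norm_chainGrad {w : ℕ → ℝ} (hw1 : ∀ k, w k ≤ 1) (hw3 : ∀ k, 1 / 3 ≤ w k) {x : Vec T}
    {i₀ : Fin T} (hx : x i₀ = 0) : 1 / 6 ≤ ‖P.chainGrad 1 w x‖ := by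
  classical
  have hex : ∃ k, |coord x k| < 1 := ⟨i₀, by simp [hx]⟩
  -- At the first coordinate smaller than `1` the preceding one has fully opened the link, so the
  -- link term is at least `1/3 · 1/2`; the cross term with link `j + 1` cannot cancel it, since
  -- `α'` dominates `|β'γ|`.
  set j := Nat.find hex with hj
  have hjT : j < T := lt_of_le_of_lt (Nat.find_min' hex (by simp [hx])) i₀.isLt
  have hjx : |x ⟨j, hjT⟩| < 1 := by
    have := Nat.find_spec hex
    rwa [← hj, show coord x j = x ⟨j, hjT⟩ from coord_fin x ⟨j, hjT⟩] at this
  have hlead : P.lead x j = 1 := by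
    rcases Nat.eq_zero_or_pos j with h | h
    · rw [h]; rfl
    · obtain ⟨k, hk⟩ := Nat.exists_eq_succ_of_ne_zero h.ne'
      rw [hk]
      exact P.β_eq_one _ (not_lt.1 (Nat.find_min hex (by omega)))
  refine le_trans ?_ (abs_apply_le_norm (P.chainGrad 1 w x) ⟨j, hjT⟩)
  rw [chainGrad_apply, abs_neg]
  refine le_trans ?_ (le_abs_self _)
  have h1 : |w (j + 1) * (P.β' (x ⟨j, hjT⟩) * P.γ (coord x (j + 1)))| ≤ P.α' (x ⟨j, hjT⟩) := by
    rw [abs_mul, abs_mul]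
    calc |w (j + 1)| * (|P.β' (x ⟨j, hjT⟩)| * |P.γ (coord x (j + 1))|)
        ≤ 1 * (|P.β' (x ⟨j, hjT⟩)| * 2) := by
          refine mul_le_mul ?_ (mul_le_mul_of_nonneg_left (P.abs_γ_le _) (abs_nonneg _))
            (by positivity) zero_le_one
          rw [abs_le]
          constructor <;> linarith [hw1 (j + 1), hw3 (j + 1)]
      _ ≤ _ := by linarith [P.abs_β'_le (x ⟨j, hjT⟩)]
  have h2 := neg_abs_le (w (j + 1) * (P.β' (x ⟨j, hjT⟩) * P.γ (coord x (j + 1))))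
  have h3 : 1 / 6 ≤ w j * (P.lead x j * P.γ' (x ⟨j, hjT⟩)) := by
    rw [hlead, one_mul]
    have := mul_le_mul (hw3 j) (P.half_le_γ' _ hjx.le) (by norm_num) (by linarith [hw3 j])
    linarith
  simp only [one_mul]
  linarith

end Profile

/-! ### Revealed prefixes -/

theorem supp_subset_iff {d c : ℕ} {v : Vec d} :
    supp v ⊆ {i | i.val < c} ↔ ∀ i : Fin d, c ≤ i.val → v i = 0 := by
  constructor
  · intro h i hi
    by_contra hv
    exact absurd (h hv) (by simpa using hi)
  · intro h i hi
    by_contra hv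
    exact hi (h i (by simpa using hv))

theorem supp_smul_subset_prefix {d c : ℕ} {v : Vec d} (t : ℝ) (h : supp v ⊆ {i | i.val < c}) :
    supp (t • v) ⊆ {i | i.val < c} := by
  rw [supp_subset_iff] at h ⊢
  intro i hi
  rw [PiLp.smul_apply, h i hi, smul_zero]

/-- The revealed coordinates form a prefix during the whole run: `c` bounds what is revealed before
a query, `c'` what its answer reveals. -/
theorem answerSupp_transcript_subset {M K R d : ℕ} (A : ZRAlgorithm M K R d) (O : Oracle M d)
    (z : Fin R × Fin K × Fin M → O.Z) (c c' : Fin R → Fin K → Fin M → ℕ)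
    (hanswer : ∀ r k m x, supp x ⊆ {i | i.val < c r k m} →
      supp (O.g (z (r, k, m)) x) ⊆ {i | i.val < c' r k m})
    (hround : ∀ r' r k' k m' m, r' < r → c' r' k' m' ≤ c r k m)
    (hlocal : ∀ r k' k m, k' < k → c' r k' m ≤ c r k m) (r : Fin R) (k : Fin K) (m : Fin M) :
    answerSupp (transcript A O z r k m) ⊆ {i | i.val < c' r k m} := by
  induction r using WellFoundedLT.induction generalizing k m with
  | ind r ihr =>
    induction k using WellFoundedLT.induction with
    | ind k ihk =>
      rw [transcript]
      refine Set.iUnion_subset fun j => hanswer r k m _ ((A.supp_query _ _ _ _ _ j).trans ?_)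
      refine Set.union_subset (Set.iUnion_subset fun l => ?_)
        (Set.iUnion_subset fun s => Set.iUnion_subset fun l => Set.iUnion_subset fun n => ?_)
      · have hl : (⟨l.val, l.isLt.trans k.isLt⟩ : Fin K) < k := l.isLt
        exact (ihk _ hl).trans fun i hi => lt_of_lt_of_le hi (hlocal _ _ _ _ hl)
      · have hs : (⟨s.val, s.isLt.trans r.isLt⟩ : Fin R) < r := s.isLt
        exact (ihr _ hs l n).trans fun i hi => lt_of_lt_of_le hi (hround _ _ _ _ _ _ hs)

theorem supp_output_subset {M K R d : ℕ} (A : ZRAlgorithm M K R d) (O : Oracle M d)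
    (z : Fin R × Fin K × Fin M → O.Z) (c c' : Fin R → Fin K → Fin M → ℕ) (N : ℕ)
    (hanswer : ∀ r k m x, supp x ⊆ {i | i.val < c r k m} →
      supp (O.g (z (r, k, m)) x) ⊆ {i | i.val < c' r k m})
    (hround : ∀ r' r k' k m' m, r' < r → c' r' k' m' ≤ c r k m)
    (hlocal : ∀ r k' k m, k' < k → c' r k' m ≤ c r k m) (hN : ∀ r k m, c' r k m ≤ N) :
    supp (A.output (transcript A O z)) ⊆ {i | i.val < N} := by
  refine (A.supp_output _).trans
    (Set.iUnion_subset fun r => Set.iUnion_subset fun k => Set.iUnion_subset fun m => ?_)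
  exact (answerSupp_transcript_subset A O z c c' hanswer hround hlocal r k m).trans
    fun i hi => lt_of_lt_of_le hi (hN r k m)

/-! ### Exact oracles -/

/-- The noiseless oracles: the datum of machine `m` is its name. -/
noncomputable abbrev exactOracle {M d : ℕ} (F : Fin M → Vec d → ℝ) : Oracle M d where
  Z := Fin M
  D := fun m => Measure.dirac m
  s := F
  g := fun m => gradient (F m)

theorem continuous_of_norm_sub_le {E E' : Type*} [SeminormedAddCommGroup E]
    [SeminormedAddCommGroup E'] {f : E → E'} {C : ℝ} (h : ∀ x y, ‖f x - f y‖ ≤ C * ‖x - y‖) :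
    Continuous f :=
  (LipschitzWith.of_dist_le_mul (K := C.toNNReal) fun x y => by
    rw [dist_eq_norm, dist_eq_norm]
    exact (h x y).trans
      (mul_le_mul_of_nonneg_right (Real.le_coe_toNNReal C) (norm_nonneg _))).continuous

theorem exactOracle_isFor {M d : ℕ} {F : Fin M → Vec d → ℝ} {H Δ τ ζ : ℝ}
    (h : InClass F H Δ τ ζ) (σ : ℝ) : (exactOracle F).IsFor F H σ where
  measurable_s := measurable_from_prod_countable_right fun m =>
    (h.differentiable m).continuous.measurable
  measurable_g := measurable_from_prod_countable_right fun m =>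
    (continuous_of_norm_sub_le (h.smooth m)).measurable
  integrable_s := fun m x => Integrable.of_finite
  integrable_g := fun m x => Integrable.of_finite
  mean_s := fun m x => integral_dirac (fun z : Fin M => F z x) m
  mean_g := fun m x => integral_dirac (fun z : Fin M => gradient (F z) x) m
  variance := fun m x => by
    change ∫⁻ z : Fin M, ‖gradient (F z) x - gradient (F m) x‖ₑ ^ 2 ∂(Measure.dirac m) ≤ _
    rw [lintegral_dirac]
    simp
  mean_smooth := fun m x y => by
    change ∫⁻ z : Fin M, ‖gradient (F z) x - gradient (F z) y‖ₑ ∂(Measure.dirac m) ≤ _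
    rw [lintegral_dirac]
    rw [← ofReal_norm]
    exact ENNReal.ofReal_le_ofReal (h.smooth m x y)

/-- The data follow a product of Dirac masses, so almost surely each datum is the name of its
machine. -/
theorem le_expectedError_exactOracle {M K R d : ℕ} (A : ZRAlgorithm M K R d)
    {F : Fin M → Vec d → ℝ} {e : ℝ≥0∞}
    (h : ∀ z : Fin R × Fin K × Fin M → Fin M, (∀ i, z i = i.2.2) →
      e ≤ ‖gradient (avg F) (A.output (transcript A (exactOracle F) z))‖ₑ ^ 2) :
    e ≤ expectedError A F (exactOracle F) := by
  have hz : ∀ᵐ z ∂(Measure.pi fun i : Fin R × Fin K × Fin M => (exactOracle F).D i.2.2),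
      ∀ i, z i = i.2.2 := by
    rw [ae_all_iff]
    intro i
    have := (measurePreserving_eval (fun i : Fin R × Fin K × Fin M => (exactOracle F).D i.2.2)
      i).quasiMeasurePreserving.ae (p := fun m : Fin M => m = i.2.2) (by
        rw [show (exactOracle F).D i.2.2 = Measure.dirac i.2.2 from rfl]
        exact (ae_dirac_iff (measurableSet_singleton _)).2 rfl)
    exact this
  calc e = ∫⁻ _, e ∂(Measure.pi fun i : Fin R × Fin K × Fin M => (exactOracle F).D i.2.2) := by
        simp
    _ ≤ _ := lintegral_mono_ae (hz.mono fun z hz => h z hz)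

/-! ### Bernoulli oracles -/

/-- The law on `Bool` with mass `p` at `true`. -/
noncomputable def bern (p : unitInterval) : Measure Bool :=
  ENNReal.ofReal p • Measure.dirac true + ENNReal.ofReal (1 - p) • Measure.dirac false

theorem lintegral_bern (p : unitInterval) (f : Bool → ℝ≥0∞) :
    ∫⁻ z, f z ∂(bern p) = ENNReal.ofReal p * f true + ENNReal.ofReal (1 - p) * f false := by
  simp [bern, lintegral_add_measure, lintegral_smul_measure]

instance (p : unitInterval) : IsProbabilityMeasure (bern p) := ⟨by
  rw [← setLIntegral_one, Measure.restrict_univ, lintegral_bern, mul_one, mul_one,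
    ← ENNReal.ofReal_add p.2.1 (by linarith [p.2.2])]
  simp⟩

theorem integral_bern {E : Type*} [NormedAddCommGroup E] [NormedSpace ℝ E] [CompleteSpace E]
    (p : unitInterval) (f : Bool → E) :
    ∫ z, f z ∂(bern p) = (p : ℝ) • f true + (1 - p : ℝ) • f false := by
  have h1 : Integrable f (ENNReal.ofReal p • Measure.dirac true) :=
    (Integrable.of_finite (μ := Measure.dirac true)).smul_measure ENNReal.ofReal_ne_top
  have h2 : Integrable f (ENNReal.ofReal (1 - p) • Measure.dirac false) :=
    (Integrable.of_finite (μ := Measure.dirac false)).smul_measure ENNReal.ofReal_ne_top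
  rw [bern, integral_add_measure h1 h2, integral_smul_measure, integral_smul_measure,
    integral_dirac, integral_dirac, ENNReal.toReal_ofReal p.2.1,
    ENNReal.toReal_ofReal (by linarith [p.2.2])]

/-- The same oracle on every machine, which hides the part `B` of the gradient `G` except with
probability `p`. -/
noncomputable abbrev bernoulliOracle (M : ℕ) {d : ℕ} (F : Vec d → ℝ) (G B : Vec d → Vec d)
    (p : unitInterval) : Oracle M d where
  Z := Bool
  D := fun _ => bern p
  s := fun _ => F
  g := fun z x => G x - (if z then (1 - (p : ℝ)⁻¹) else 1) • B x

/-- The mask has mean `p(1 - 1/p) + (1 - p) = 0`. -/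
theorem integral_bern_masked {E : Type*} [NormedAddCommGroup E] [NormedSpace ℝ E]
    [CompleteSpace E] {p : unitInterval} (hp : 0 < (p : ℝ)) (a b : E) :
    ∫ z : Bool, (a - (if z then (1 - (p : ℝ)⁻¹) else 1) • b) ∂(bern p) = a := by
  rw [integral_bern]
  simp only [if_true, Bool.false_eq_true, if_false, one_smul]
  have e : (p : ℝ) * (1 - (p : ℝ)⁻¹) = p - 1 := by field_simp
  rw [smul_sub, smul_sub, smul_smul, e]
  module

/-- The mask has second moment `(1 - p)/p`, at most `1/p`. -/
theorem lintegral_bern_masked_variance_le {E : Type*} [NormedAddCommGroup E] [NormedSpace ℝ E]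
    {p : unitInterval} {σ : ℝ} (hp : 0 < (p : ℝ)) (a b : E) (hσ : ‖b‖ ^ 2 ≤ p * σ ^ 2) :
    ∫⁻ z : Bool, ‖a - (if z then (1 - (p : ℝ)⁻¹) else 1) • b - a‖ₑ ^ 2 ∂(bern p)
      ≤ ENNReal.ofReal (σ ^ 2) := by
  rw [lintegral_bern]
  have hp1 := p.2.2
  have e : ∀ t : ℝ, ‖a - t • b - a‖ₑ ^ 2 = ENNReal.ofReal (t ^ 2 * ‖b‖ ^ 2) := by
    intro t
    rw [sub_sub_cancel_left, enorm_neg, ← ofReal_norm, ← ENNReal.ofReal_pow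
      (norm_nonneg _), norm_smul, mul_pow, Real.norm_eq_abs, sq_abs]
  rw [e, e, ← ENNReal.ofReal_mul hp.le, ← ENNReal.ofReal_mul (by linarith),
    ← ENNReal.ofReal_add (by positivity) (mul_nonneg (by linarith) (by positivity))]
  refine ENNReal.ofReal_le_ofReal ?_
  simp only [if_true, Bool.false_eq_true, if_false]
  have e2 : (p : ℝ) * ((1 - (p : ℝ)⁻¹) ^ 2 * ‖b‖ ^ 2) + (1 - p) * (1 ^ 2 * ‖b‖ ^ 2)
      = (1 - p) * (‖b‖ ^ 2 / p) := by field_simp; ring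
  rw [e2]
  have e3 : ‖b‖ ^ 2 / p ≤ σ ^ 2 := by rw [div_le_iff₀ hp, mul_comm]; exact hσ
  have e4 : 0 ≤ ‖b‖ ^ 2 / p := by positivity
  nlinarith

/-- The mask has first absolute moment `2(1 - p)`, bounded uniformly in `p`; a second-moment
smoothness condition would cost a factor growing like `1/p`. -/
theorem lintegral_bern_masked_sub_le {E : Type*} [NormedAddCommGroup E] [NormedSpace ℝ E]
    {p : unitInterval} (hp : 0 < (p : ℝ)) (a b a' b' : E) {C : ℝ}
    (hC : ‖a - a'‖ + 2 * ‖b - b'‖ ≤ C) :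
    ∫⁻ z : Bool, ‖a - (if z then (1 - (p : ℝ)⁻¹) else 1) • b
      - (a' - (if z then (1 - (p : ℝ)⁻¹) else 1) • b')‖ₑ ∂(bern p) ≤ ENNReal.ofReal C := by
  rw [lintegral_bern]
  have hp1 := p.2.2
  have e : ∀ t : ℝ, ‖a - t • b - (a' - t • b')‖ₑ
      ≤ ENNReal.ofReal (‖a - a'‖ + |t| * ‖b - b'‖) := by
    intro t
    rw [← ofReal_norm]
    refine ENNReal.ofReal_le_ofReal ?_
    rw [show a - t • b - (a' - t • b') = (a - a') - t • (b - b') by module]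
    refine (norm_sub_le _ _).trans (le_of_eq ?_)
    rw [norm_smul, Real.norm_eq_abs]
  refine (add_le_add (mul_le_mul_right (e _) _) (mul_le_mul_right (e _) _)).trans ?_
  rw [← ENNReal.ofReal_mul hp.le, ← ENNReal.ofReal_mul (by linarith),
    ← ENNReal.ofReal_add (by positivity) (mul_nonneg (by linarith) (by positivity))]
  refine ENNReal.ofReal_le_ofReal ?_
  simp only [if_true, Bool.false_eq_true, if_false, abs_one, one_mul]
  have h1 : |1 - (p : ℝ)⁻¹| = (1 - p) / p := by
    rw [abs_of_nonpos (sub_nonpos.2 ((one_le_inv₀ hp).2 hp1))]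
    field_simp; ring
  have e2 : (p : ℝ) * (‖a - a'‖ + (1 - p) / p * ‖b - b'‖)
      + (1 - p) * (‖a - a'‖ + ‖b - b'‖) = ‖a - a'‖ + 2 * (1 - p) * ‖b - b'‖ := by
    field_simp; ring
  rw [h1, e2]
  have h4 := norm_nonneg (b - b')
  nlinarith [mul_nonneg hp.le h4]

theorem bernoulliOracle_isFor {M d : ℕ} {F : Vec d → ℝ} {G B : Vec d → Vec d} {p : unitInterval}
    {H σ ℓ₁ ℓ₂ : ℝ} (hp : 0 < (p : ℝ)) (hF : Continuous F) (hgrad : gradient F = G)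
    (hG : ∀ x y, ‖G x - G y‖ ≤ ℓ₁ * ‖x - y‖) (hB : ∀ x y, ‖B x - B y‖ ≤ ℓ₂ * ‖x - y‖)
    (hH : ℓ₁ + 2 * ℓ₂ ≤ H) (hσ : ∀ x, ‖B x‖ ^ 2 ≤ p * σ ^ 2) :
    (bernoulliOracle M F G B p).IsFor (fun _ => F) H σ := by
  have hGc := continuous_of_norm_sub_le hG
  have hBc := continuous_of_norm_sub_le hB
  subst hgrad
  have hms : Measurable fun q : Bool × Vec d => F q.2 := hF.measurable.comp measurable_snd
  have hmg : Measurable fun q : Bool × Vec d =>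
      gradient F q.2 - (if q.1 then (1 - (p : ℝ)⁻¹) else 1) • B q.2 :=
    (hGc.measurable.comp measurable_snd).sub
      (((measurable_of_countable fun z : Bool => if z then (1 - (p : ℝ)⁻¹) else 1).comp
        measurable_fst).smul (hBc.measurable.comp measurable_snd))
  have hfin : ∀ {E : Type} [NormedAddCommGroup E] (f : Bool → E), Integrable f (bern p) :=
    fun f => Integrable.of_finite
  refine ⟨hms, hmg, fun _ x => hfin _, fun _ x => hfin _, ?_, ?_, ?_, ?_⟩
  · intro _ x
    change ∫ _ : Bool, F x ∂(bern p) = F x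
    rw [integral_const, probReal_univ, one_smul]
  · exact fun _ x => integral_bern_masked hp (gradient F x) (B x)
  · exact fun _ x => lintegral_bern_masked_variance_le hp (gradient F x) (B x) (hσ x)
  · intro _ x y
    refine lintegral_bern_masked_sub_le hp (gradient F x) (B x) (gradient F y) (B y) ?_
    have h5 := mul_le_mul_of_nonneg_right hH (norm_nonneg (x - y))
    linarith [hG x y, hB x y]

/-- Markov's inequality for the number of successes among independent Bernoulli trials. -/
theorem half_le_measure_count_lt {ι : Type*} [Fintype ι] (p : unitInterval) {T : ℕ}
    (hT : 0 < T) (hp : 2 * (Fintype.card ι * (p : ℝ)) ≤ T) :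
    2⁻¹ ≤ (Measure.pi fun _ : ι => bern p)
      {z | (Finset.univ.filter fun i => z i = true).card < T} := by
  classical
  set μ := Measure.pi fun _ : ι => bern p
  set S : Set (ι → Bool) := {z | (Finset.univ.filter fun i => z i = true).card < T} with hS
  have hmeas : ∀ i : ι, Measurable fun z : ι → Bool => if z i = true then (1 : ℝ≥0∞) else 0 :=
    fun i => (measurable_of_countable (fun b : Bool => if b = true then (1 : ℝ≥0∞) else 0)).comp
      (measurable_pi_apply i)
  have hsum : ∀ z : ι → Bool, ((Finset.univ.filter fun i => z i = true).card : ℝ≥0∞)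
      = ∑ i, if z i = true then (1 : ℝ≥0∞) else 0 := fun z => by simp
  have hSm : MeasurableSet S := MeasurableSet.of_discrete
  have hint : ∫⁻ z, ((Finset.univ.filter fun i => z i = true).card : ℝ≥0∞) ∂μ
      = Fintype.card ι * ENNReal.ofReal p := by
    simp only [hsum]
    rw [lintegral_finsetSum _ fun i _ => hmeas i]
    have : ∀ i : ι, ∫⁻ z, (if z i = true then (1 : ℝ≥0∞) else 0) ∂μ = ENNReal.ofReal p := by
      intro i
      have h1 := (measurePreserving_eval (fun _ : ι => bern p) i).lintegral_comp
        (measurable_of_countable (fun b : Bool => if b = true then (1 : ℝ≥0∞) else 0))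
      rw [lintegral_bern] at h1
      simpa using h1
    simp [this]
  have hmarkov := mul_meas_ge_le_lintegral₀ (μ := μ)
    (f := fun z => ((Finset.univ.filter fun i => z i = true).card : ℝ≥0∞))
    (by simp only [hsum]; exact (Finset.measurable_sum _ fun i _ => hmeas i).aemeasurable) T
  have hSc : {z : ι → Bool | (T : ℝ≥0∞) ≤ ((Finset.univ.filter fun i => z i = true).card : ℝ≥0∞)}
      = Sᶜ := by
    ext z; simp [hS]
  rw [hSc, hint] at hmarkov
  have hT' : (T : ℝ≥0∞) ≠ 0 := by exact_mod_cast hT.ne'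
  have h2 : (Fintype.card ι : ℝ≥0∞) * ENNReal.ofReal p ≤ T * 2⁻¹ := by
    rw [← div_eq_mul_inv, ENNReal.le_div_iff_mul_le (Or.inl two_ne_zero) (Or.inl ENNReal.ofNat_ne_top)]
    have := ENNReal.ofReal_le_ofReal hp
    rw [ENNReal.ofReal_mul zero_le_two, ENNReal.ofReal_mul (Nat.cast_nonneg _),
      ENNReal.ofReal_natCast, ENNReal.ofReal_natCast, ENNReal.ofReal_ofNat, mul_comm] at this
    exact this
  have h3 : μ Sᶜ ≤ 2⁻¹ := by
    have := hmarkov.trans h2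
    exact (ENNReal.mul_le_mul_iff_right hT' (ENNReal.natCast_ne_top T)).1 this
  have h4 : μ S + μ Sᶜ = 1 := by rw [measure_add_measure_compl hSm, measure_univ]
  by_contra hlt
  rw [not_le] at hlt
  have : μ S + μ Sᶜ < 2⁻¹ + 2⁻¹ :=
    ENNReal.add_lt_add_of_lt_of_le (measure_ne_top _ _) hlt h3
  rw [h4, ENNReal.inv_two_add_inv_two] at this
  exact lt_irrefl _ this

/-- Only the event of fewer than `T` successes is kept; the hypothesis on `p` makes the expected
number at most `T/2`, so this event has probability at least `1/2`. -/
theorem le_expectedError_bernoulliOracle {M K R d : ℕ} (A : ZRAlgorithm M K R d)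
    {F : Fin M → Vec d → ℝ} {F₀ : Vec d → ℝ} {G B : Vec d → Vec d} {p : unitInterval} {e : ℝ≥0∞}
    {T : ℕ} (hT : 0 < T) (hp : 2 * ((R * (K * M) : ℝ) * (p : ℝ)) ≤ T)
    (h : ∀ z : Fin R × Fin K × Fin M → Bool,
      (Finset.univ.filter fun i => z i = true).card < T →
      e ≤ ‖gradient (avg F) (A.output (transcript A (bernoulliOracle M F₀ G B p) z))‖ₑ ^ 2) :
    e * 2⁻¹ ≤ expectedError A F (bernoulliOracle M F₀ G B p) := by
  have hm := half_le_measure_count_lt (ι := Fin R × Fin K × Fin M) p hT (by simpa using hp)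
  set S : Set (Fin R × Fin K × Fin M → Bool) :=
    {z | (Finset.univ.filter fun i => z i = true).card < T} with hS
  have hSm : MeasurableSet S := MeasurableSet.of_discrete
  calc e * 2⁻¹ ≤ e * (Measure.pi fun _ : Fin R × Fin K × Fin M => bern p) S := by gcongr
    _ = ∫⁻ _ in S, e ∂(Measure.pi fun _ : Fin R × Fin K × Fin M => bern p) := by
        rw [setLIntegral_const]
    _ ≤ ∫⁻ z in S, ‖gradient (avg F)
          (A.output (transcript A (bernoulliOracle M F₀ G B p) z))‖ₑ ^ 2
          ∂(Measure.pi fun _ : Fin R × Fin K × Fin M => bern p) :=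
        setLIntegral_mono' hSm fun z hz => h z hz
    _ ≤ _ := setLIntegral_le_lintegral _ _

theorem norm_rescale_sub_le {E E' : Type*} [NormedAddCommGroup E] [NormedSpace ℝ E]
    [NormedAddCommGroup E'] [NormedSpace ℝ E'] {g : E → E'} {a μ ℓ : ℝ} (ha : 0 ≤ a) (hμ : 0 ≤ μ)
    (hg : ∀ x y, ‖g x - g y‖ ≤ ℓ * ‖x - y‖) (x y : E) :
    ‖(a * μ) • g (μ • x) - (a * μ) • g (μ • y)‖ ≤ a * μ ^ 2 * ℓ * ‖x - y‖ := by
  rw [← smul_sub, norm_smul, Real.norm_of_nonneg (mul_nonneg ha hμ)]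
  have h := hg (μ • x) (μ • y)
  rw [← smul_sub, norm_smul, Real.norm_of_nonneg hμ] at h
  calc a * μ * ‖g (μ • x) - g (μ • y)‖ ≤ a * μ * (ℓ * (μ * ‖x - y‖)) :=
        mul_le_mul_of_nonneg_left h (mul_nonneg ha hμ)
    _ = _ := by ring

namespace Profile

variable (P : Profile) {T : ℕ}

/-! ### Support of the gradient of the chain -/

theorem lead_eq_zero {c : ℕ} {x : Vec T} (hx : supp x ⊆ {i | i.val < c}) {k : ℕ} (hk : c < k) :
    P.lead x k = 0 := by
  rw [supp_subset_iff] at hx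
  obtain ⟨j, rfl⟩ : ∃ j, k = j + 1 := ⟨k - 1, by omega⟩
  have : coord x j = 0 := by
    unfold coord
    split_ifs with h
    · exact hx ⟨j, h⟩ (by simp; omega)
    · rfl
  rw [lead, this]
  exact P.β_eq_zero 0 (by norm_num)

/-- At a zero coordinate `α'` and `β'` vanish and `γ' = 1`, so only the coupling to the preceding
coordinate survives; by `lead_eq_zero` it dies beyond the first unrevealed coordinate. -/
theorem chainGrad_apply_of_prefix {c : ℕ} {x : Vec T} (hx : supp x ⊆ {i | i.val < c})
    (s : ℝ) (w : ℕ → ℝ) {i : Fin T} (hi : c ≤ i.val) :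
    P.chainGrad s w x i = -(w i * P.lead x i) := by
  rw [supp_subset_iff] at hx
  rw [chainGrad_apply, hx i hi, P.α'_zero, P.β'_zero, P.γ'_zero]
  ring

theorem supp_chainGrad_subset {c : ℕ} {x : Vec T} (hx : supp x ⊆ {i | i.val < c})
    (s : ℝ) (w : ℕ → ℝ) : supp (P.chainGrad s w x) ⊆ {i | i.val < c + 1} := by
  rw [supp_subset_iff]
  intro i hi
  rw [P.chainGrad_apply_of_prefix hx s w (by omega), P.lead_eq_zero hx (by omega)]
  simp

theorem supp_chainGrad_subset_of_weight_eq_zero {c : ℕ} {x : Vec T}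
    (hx : supp x ⊆ {i | i.val < c}) (s : ℝ) {w : ℕ → ℝ} (hw : w c = 0) :
    supp (P.chainGrad s w x) ⊆ {i | i.val < c} := by
  rw [supp_subset_iff]
  intro i hi
  rw [P.chainGrad_apply_of_prefix hx s w hi]
  rcases hi.eq_or_lt with h | h
  · rw [← h, hw]; simp
  · rw [P.lead_eq_zero hx h]; simp

/-! ### The part of the gradient which a Bernoulli oracle hides -/

end Profile

/-- The distance of `x` to the vectors supported on the first `k` coordinates. -/
noncomputable def tailDist {T : ℕ} (x : Vec T) (k : ℕ) : ℝ :=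
  Metric.infDist x {y : Vec T | supp y ⊆ {i | i.val < k}}

theorem nonempty_prefix (T k : ℕ) : {y : Vec T | supp y ⊆ {i | i.val < k}}.Nonempty :=
  ⟨0, by
    change supp (0 : Vec T) ⊆ {i | i.val < k}
    rw [supp_subset_iff]; simp⟩

theorem tailDist_eq_zero {T k : ℕ} {x : Vec T} (hx : supp x ⊆ {i | i.val < k}) :
    tailDist x k = 0 :=
  Metric.infDist_zero_of_mem hx

theorem abs_apply_le_tailDist {T k : ℕ} (x : Vec T) {i : Fin T} (hi : k ≤ i.val) :
    |x i| ≤ tailDist x k := by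
  refine (Metric.le_infDist (nonempty_prefix T k)).2 fun y hy => ?_
  have h := abs_apply_le_norm (x - y) i
  rwa [PiLp.sub_apply, supp_subset_iff.1 hy i hi, sub_zero, ← dist_eq_norm] at h

theorem abs_tailDist_sub_le {T k : ℕ} (x y : Vec T) :
    |tailDist x k - tailDist y k| ≤ ‖x - y‖ := by
  have := (Metric.lipschitz_infDist_pt {y : Vec T | supp y ⊆ {i | i.val < k}}).dist_le_mul x y
  rwa [Real.dist_eq, dist_eq_norm, NNReal.coe_one, one_mul] at this

theorem abs_prevCoord_le_norm {T : ℕ} (x : Vec T) (k : ℕ) : |prevCoord x k| ≤ ‖x‖ := by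
  cases k with
  | zero => simp [prevCoord]
  | succ k =>
    rw [prevCoord, coord]
    split_ifs
    · exact abs_apply_le_norm x _
    · simp

theorem norm_sq_le_card_mul {T : ℕ} {u : Vec T} {s : Finset (Fin T)} {C : ℝ}
    (hs : ∀ i ∉ s, u i = 0) (hC : ∀ i, |u i| ≤ C) : ‖u‖ ^ 2 ≤ s.card * C ^ 2 := by
  rw [EuclideanSpace.real_norm_sq_eq, ← Finset.sum_subset (Finset.subset_univ s)
    (fun i _ hi => by rw [hs i hi]; simp)]
  refine (Finset.sum_le_card_nsmul s _ (C ^ 2) fun i _ => ?_).trans (le_of_eq (nsmul_eq_mul _ _))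
  rw [← sq_abs]
  exact pow_le_pow_left₀ (abs_nonneg _) (hC i) 2

namespace Profile

variable (P : Profile) {T : ℕ}

/-- The part of the gradient of the chain which makes progress. -/
noncomputable def hidden (x : Vec T) : Vec T :=
  WithLp.toLp 2 fun i => -max 0 (P.lead x i - 2 * tailDist x i)

theorem hidden_apply (x : Vec T) (i : Fin T) :
    P.hidden x i = -max 0 (P.lead x i - 2 * tailDist x i) := rfl

/-- On a prefix the distance term vanishes, so for unit weights `hidden` agrees with the chain
gradient beyond the prefix. Subtracting it erases all progress. -/
theorem hidden_apply_of_prefix {c : ℕ} {x : Vec T} (hx : supp x ⊆ {i | i.val < c}) {i : Fin T}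
    (hi : c ≤ i.val) : P.hidden x i = -P.lead x i := by
  rw [hidden_apply, tailDist_eq_zero (hx.trans fun j hj => lt_of_lt_of_le hj hi), mul_zero,
    sub_zero, max_eq_right (P.lead_nonneg _ _)]

theorem abs_hidden_apply_le (x : Vec T) (i : Fin T) : |P.hidden x i| ≤ 1 := by
  have h0 : 0 ≤ tailDist x i := Metric.infDist_nonneg
  rw [hidden_apply, abs_neg, abs_of_nonneg (le_max_left _ _)]
  exact max_le zero_le_one (by linarith [P.lead_le_one x i])

theorem hidden_lip_apply (x y : Vec T) (i : Fin T) :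
    |(P.hidden x - P.hidden y) i| ≤ (P.L + 2) * ‖x - y‖ := by
  rw [PiLp.sub_apply, hidden_apply, hidden_apply, neg_sub_neg, abs_sub_comm]
  rw [max_comm 0, max_comm 0]
  refine (abs_max_sub_max_le_abs _ _ _).trans ?_
  have h1 := P.lead_lip x y i
  have h2 := abs_tailDist_sub_le (k := i) x y
  have h3 := mul_le_mul_of_nonneg_left (abs_prevCoord_le_norm (x - y) i) P.L_pos.le
  rw [show P.lead x i - 2 * tailDist x i - (P.lead y i - 2 * tailDist y i)
    = (P.lead x i - P.lead y i) - 2 * (tailDist x i - tailDist y i) by ring]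
  refine (abs_sub _ _).trans ?_
  rw [abs_mul, abs_two]
  linarith

/-- A nonzero entry `j` needs an open link, hence `|x_{j-1}| > 1/2`. That coordinate lies in the
tail of every `i < j`, where twice the tail distance then exceeds `lead ≤ 1`. So the distance term
leaves at most one nonzero entry, which makes norm and Lipschitz constant independent of `T`. -/
theorem hidden_eq_zero_of_lt {x : Vec T} {i j : Fin T} (hij : i < j) (hj : P.hidden x j ≠ 0) :
    P.hidden x i = 0 := by
  rw [hidden_apply, neg_eq_zero]
  refine max_eq_left ?_
  have h0 : 0 ≤ tailDist x j := Metric.infDist_nonneg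
  have hlead : 0 < P.lead x j := by
    by_contra h
    refine hj ?_
    rw [hidden_apply, max_eq_left (by linarith), neg_zero]
  obtain ⟨n, hn⟩ : ∃ n, j.val = n + 1 := ⟨j.val - 1, by have : i.val < j.val := hij; omega⟩
  have hnT : n < T := by omega
  rw [hn, lead, show coord x n = x ⟨n, hnT⟩ from coord_fin x ⟨n, hnT⟩] at hlead
  have h1 : 1 / 2 < |x ⟨n, hnT⟩| := by
    by_contra h
    exact hlead.ne' (P.β_eq_zero _ (not_lt.1 h))
  have h2 := abs_apply_le_tailDist x (k := i) (i := ⟨n, hnT⟩)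
    (by have : i.val < j.val := hij; change i.val ≤ n; omega)
  linarith [P.lead_le_one x i]

theorem exists_hidden_support (x : Vec T) :
    ∃ s : Finset (Fin T), s.card ≤ 1 ∧ ∀ i ∉ s, P.hidden x i = 0 := by
  classical
  refine ⟨Finset.univ.filter fun i => P.hidden x i ≠ 0, ?_, fun i hi => by simpa using hi⟩
  rw [Finset.card_le_one]
  intro i hi j hj
  simp only [Finset.mem_filter, Finset.mem_univ, true_and] at hi hj
  rcases lt_trichotomy i j with h | h | h
  · exact absurd (P.hidden_eq_zero_of_lt h hj) hi
  · exact h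
  · exact absurd (P.hidden_eq_zero_of_lt h hi) hj

theorem norm_hidden_sq_le (x : Vec T) : ‖P.hidden x‖ ^ 2 ≤ 1 := by
  obtain ⟨s, hs, h⟩ := P.exists_hidden_support x
  refine (norm_sq_le_card_mul h (P.abs_hidden_apply_le x)).trans ?_
  have : (s.card : ℝ) ≤ 1 := by exact_mod_cast hs
  linarith

theorem hidden_lip (x y : Vec T) : ‖P.hidden x - P.hidden y‖ ≤ 4 * P.L * ‖x - y‖ := by
  classical
  obtain ⟨s, hs, h⟩ := P.exists_hidden_support x
  obtain ⟨s', hs', h'⟩ := P.exists_hidden_support y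
  have h1 := norm_sq_le_card_mul (u := P.hidden x - P.hidden y) (s := s ∪ s') (fun i hi => by
    rw [Finset.notMem_union] at hi
    rw [PiLp.sub_apply, h i hi.1, h' i hi.2, sub_zero]) (P.hidden_lip_apply x y)
  have h2 : ((s ∪ s').card : ℝ) ≤ 2 := by
    exact_mod_cast (Finset.card_union_le s s').trans (by omega)
  have hL := P.two_le_L
  refine le_of_sq_le_sq ?_ (by positivity)
  -- A difference of two hidden parts has at most two nonzero entries; `√2 · 2L ≤ 4L`.
  have h3 : (P.L + 2) * ‖x - y‖ ≤ 2 * P.L * ‖x - y‖ :=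
    mul_le_mul_of_nonneg_right (by linarith) (norm_nonneg _)
  have h4 := pow_le_pow_left₀ (by positivity) h3 2
  calc _ ≤ _ := h1
    _ ≤ 2 * ((P.L + 2) * ‖x - y‖) ^ 2 := mul_le_mul_of_nonneg_right h2 (sq_nonneg _)
    _ ≤ (4 * P.L * ‖x - y‖) ^ 2 := by nlinarith

/-! ### The rescaled chain -/

/-- The chain with amplitude `a` and inverse length scale `μ`. -/
noncomputable def scaled (a μ : ℝ) (w : ℕ → ℝ) (x : Vec T) : ℝ := a * P.chain 1 w (μ • x)

/-- The gradient of the rescaled chain. -/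
noncomputable def scaledGrad (a μ : ℝ) (w : ℕ → ℝ) (x : Vec T) : Vec T :=
  (a * μ) • P.chainGrad 1 w (μ • x)

theorem hasGradientAt_scaled (a μ : ℝ) (w : ℕ → ℝ) (x : Vec T) :
    HasGradientAt (P.scaled a μ w) (P.scaledGrad a μ w x) x := by
  have h := (P.hasGradientAt_chain 1 w (μ • x)).hasFDerivAt
  rw [hasGradientAt_iff_hasFDerivAt]
  have hs : HasFDerivAt (fun y : Vec T => μ • y) (μ • ContinuousLinearMap.id ℝ (Vec T)) x :=
    (hasFDerivAt_id x).const_smul μ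
  refine ((h.comp x hs).const_mul a).congr_fderiv ?_
  ext v
  simp [scaledGrad, mul_assoc]

theorem gradient_scaled (a μ : ℝ) (w : ℕ → ℝ) :
    gradient (P.scaled a μ w : Vec T → ℝ) = P.scaledGrad a μ w :=
  funext fun x => (P.hasGradientAt_scaled a μ w x).gradient

theorem scaledGrad_lip {a μ : ℝ} (ha : 0 ≤ a) (hμ : 0 ≤ μ) {w : ℕ → ℝ} (hw : ∀ k, |w k| ≤ 1)
    (x y : Vec T) :
    ‖P.scaledGrad a μ w x - P.scaledGrad a μ w y‖ ≤ a * μ ^ 2 * (12 * P.L) * ‖x - y‖ :=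
  norm_rescale_sub_le ha hμ (P.chainGrad_lip (by simp) hw) x y

/-- The `α` part is common to all machines and cancels; the parameter `s` of the chain exists so
that differences are again chains, with `s = 0`. -/
theorem scaledGrad_sub (a μ : ℝ) (w w' : ℕ → ℝ) (x : Vec T) :
    P.scaledGrad a μ w x - P.scaledGrad a μ w' x
      = (a * μ) • P.chainGrad 0 (fun k => w k - w' k) (μ • x) := by
  rw [scaledGrad, scaledGrad, ← smul_sub]
  congr 1
  ext i
  rw [PiLp.sub_apply, chainGrad_apply, chainGrad_apply, chainGrad_apply]
  ring

theorem differentiable_scaledGrad (a μ : ℝ) (w : ℕ → ℝ) :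
    Differentiable ℝ (P.scaledGrad a μ w : Vec T → Vec T) :=
  ((P.differentiable_chainGrad 1 w).comp (differentiable_id.const_smul μ)).const_smul (a * μ)

/-- The mean of the weights of all machines. -/
noncomputable def meanWeight {M : ℕ} (w : Fin M → ℕ → ℝ) (k : ℕ) : ℝ := (∑ m, w m k) / M

theorem avg_scaled {M : ℕ} (hM : 0 < M) (a μ : ℝ) (w : Fin M → ℕ → ℝ) :
    avg (fun m => (P.scaled a μ (w m) : Vec T → ℝ)) = P.scaled a μ (meanWeight w) := by
  have hM' : (M : ℝ) ≠ 0 := by positivity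
  funext x
  have h : ∑ m, P.chain 1 (w m) (μ • x) = M * P.chain 1 (meanWeight w) (μ • x) := by
    simp only [chain]
    rw [Finset.sum_neg_distrib, Finset.sum_comm, mul_neg, Finset.mul_sum]
    congr 1
    refine Finset.sum_congr rfl fun k _ => ?_
    rw [Finset.sum_add_distrib, meanWeight]
    simp only [Finset.sum_const, Finset.card_univ, Fintype.card_fin, nsmul_eq_mul]
    rw [show ∑ m, w m k * (P.lead (μ • x) k * P.γ (coord (μ • x) k))
      = (∑ m, w m k) * (P.lead (μ • x) k * P.γ (coord (μ • x) k)) from (Finset.sum_mul _ _ _).symm]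
    field_simp
  simp only [avg, scaled]
  rw [← Finset.mul_sum, h]
  field_simp

theorem scaled_inClass {M : ℕ} (hM : 0 < M) {a μ H Δ τ ζ : ℝ} (ha : 0 ≤ a) (hμ : 0 ≤ μ)
    (hH : a * μ ^ 2 * (12 * P.L) ≤ H) (hΔ : 8 * T * a ≤ Δ) (hτ : 0 ≤ τ) (hζ : 0 ≤ H * ζ)
    {w : Fin M → ℕ → ℝ} (hw0 : ∀ m k, 0 ≤ w m k) (hw1 : ∀ m k, w m k ≤ 1)
    (hhet : (∀ m n, w m = w n) ∨
      a * μ ^ 2 * (12 * P.L) ≤ τ ∧ (a * μ) ^ 2 * (9 * P.L ^ 2 * T) ≤ (H * ζ) ^ 2) :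
    InClass (fun m => (P.scaled a μ (w m) : Vec T → ℝ)) H Δ τ ζ := by
  have hw : ∀ m k, |w m k| ≤ 1 := fun m k => by rw [abs_of_nonneg (hw0 m k)]; exact hw1 m k
  have hww : ∀ m n k, |w m k - w n k| ≤ 1 := fun m n k => by
    rw [abs_le]; constructor <;> linarith [hw0 m k, hw0 n k, hw1 m k, hw1 n k]
  refine ⟨fun m x => (P.hasGradientAt_scaled a μ (w m) x).differentiableAt, fun m => ?_, ?_, ?_,
    ?_, ?_⟩
  · rw [gradient_scaled]; exact P.differentiable_scaledGrad _ _ _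
  · intro m x y
    rw [gradient_scaled]
    exact (P.scaledGrad_lip ha hμ (hw m) x y).trans
      (mul_le_mul_of_nonneg_right hH (norm_nonneg _))
  · intro x
    have hM' : (0 : ℝ) < M := by exact_mod_cast hM
    have hmw : ∀ k, |meanWeight w k| ≤ 1 := fun k => by
      rw [meanWeight, abs_of_nonneg (div_nonneg (Finset.sum_nonneg fun m _ => hw0 m k) hM'.le),
        div_le_one hM']
      refine (Finset.sum_le_sum fun m _ => hw1 m k).trans (by simp)
    rw [P.avg_scaled hM, scaled, scaled, ← mul_sub]
    refine le_trans ?_ hΔ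
    have h1 := abs_le.1 (P.abs_chain_le (s := 1) (by simp) hmw (μ • (0 : Vec T)))
    have h2 := abs_le.1 (P.abs_chain_le (s := 1) (by simp) hmw (μ • x))
    rw [mul_comm _ a]
    exact mul_le_mul_of_nonneg_left (by linarith) ha
  · intro m n x
    rw [gradient_scaled, gradient_scaled]
    rcases hhet with h | ⟨h, -⟩
    · rw [h m n, sub_self, norm_zero]; exact hτ
    · rw [← fderiv_fun_sub (P.differentiable_scaledGrad _ _ _ x)
        (P.differentiable_scaledGrad _ _ _ x)]
      simp only [scaledGrad_sub]
      -- The Hessian difference is bounded by the Lipschitz constant of the gradient difference,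
      -- itself a chain gradient with `s = 0`.
      refine norm_fderiv_le_of_lip' ℝ hτ (Filter.Eventually.of_forall fun y => ?_)
      refine (norm_rescale_sub_le ha hμ (P.chainGrad_lip (s := 0) (by simp) (hww m n)) y x).trans
        (mul_le_mul_of_nonneg_right h (norm_nonneg _))
  · intro m n x
    rw [gradient_scaled, gradient_scaled]
    rcases hhet with h | ⟨-, h⟩
    · rw [h m n, sub_self, norm_zero]; exact hζ
    · rw [scaledGrad_sub]
      refine le_of_sq_le_sq ?_ hζ
      rw [norm_smul, mul_pow, Real.norm_eq_abs, sq_abs]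
      exact (mul_le_mul_of_nonneg_left (P.norm_chainGrad_sq_le (s := 0) (by simp) (hww m n) _)
        (sq_nonneg _)).trans h

theorem le_enorm_gradient_avg_scaled {M : ℕ} (hM : 0 < M) {a μ : ℝ}
    {w : Fin M → ℕ → ℝ} (hw1 : ∀ k, meanWeight w k ≤ 1) (hw3 : ∀ k, 1 / 3 ≤ meanWeight w k)
    {x : Vec T} {N : ℕ} (hN : N < T) (hx : supp x ⊆ {i | i.val < N}) :
    ENNReal.ofReal ((a * μ) ^ 2 / 36)
      ≤ ‖gradient (avg fun m => (P.scaled a μ (w m) : Vec T → ℝ)) x‖ₑ ^ 2 := by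
  rw [P.avg_scaled hM, gradient_scaled, scaledGrad, ← ofReal_norm, ← ENNReal.ofReal_pow
    (norm_nonneg _), norm_smul, mul_pow ‖_‖, Real.norm_eq_abs, sq_abs, div_eq_mul_inv]
  refine ENNReal.ofReal_le_ofReal (mul_le_mul_of_nonneg_left ?_ (sq_nonneg _))
  have h0 : (μ • x) ⟨N, hN⟩ = 0 := by
    rw [PiLp.smul_apply, supp_subset_iff.1 hx ⟨N, hN⟩ le_rfl, smul_zero]
  have := pow_le_pow_left₀ (by norm_num) (P.le_norm_chainGrad hw1 hw3 h0) 2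
  linarith

end Profile

/-! ### Lower bounds from the three hard instances -/

/-- Some problem in the class forces the error `e` upon every zero-respecting algorithm. -/
def Forces (M K R : ℕ) (H Δ τ ζ σ e : ℝ) : Prop :=
  ∃ (d : ℕ) (F : Fin M → Vec d → ℝ) (O : Oracle M d), InClass F H Δ τ ζ ∧ O.IsFor F H σ ∧
    ∀ A : ZRAlgorithm M K R d, ENNReal.ofReal e ≤ expectedError A F O

theorem Forces.mono {M K R : ℕ} {H Δ τ ζ σ e e' : ℝ} (h : Forces M K R H Δ τ ζ σ e)
    (he : e' ≤ e) : Forces M K R H Δ τ ζ σ e' := by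
  obtain ⟨d, F, O, hF, hO, hA⟩ := h
  exact ⟨d, F, O, hF, hO, fun A => (ENNReal.ofReal_le_ofReal he).trans (hA A)⟩

theorem sum_range_parity (ρ M : ℕ) (hρ : ρ < 2) :
    ∑ m ∈ Finset.range M, (if ρ = m % 2 then 1 else 0) = (M + 1 - ρ) / 2 := by
  induction M with
  | zero => simp; omega
  | succ M ih =>
    rw [Finset.sum_range_succ, ih]
    split_ifs with h <;> omega

/-- The weights of machine `m` in the heterogeneous instance: links of the parity of `m`. -/
noncomputable def parityWeight {M : ℕ} (m : Fin M) (k : ℕ) : ℝ :=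
  if k % 2 = m.val % 2 then 1 else 0

theorem third_le_meanWeight_parity {M : ℕ} (hM : 2 ≤ M) (k : ℕ) :
    1 / 3 ≤ Profile.meanWeight (parityWeight (M := M)) k := by
  have h1 : ∑ m : Fin M, parityWeight m k = ((M + 1 - k % 2) / 2 : ℕ) := by
    rw [← sum_range_parity (k % 2) M (Nat.mod_lt _ two_pos), ← Fin.sum_univ_eq_sum_range
      (fun m => if k % 2 = m % 2 then 1 else 0)]
    simp [parityWeight]
  have hM' : (0 : ℝ) < M := by positivity
  rw [Profile.meanWeight, h1, le_div_iff₀ hM']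
  have h2 : M ≤ 3 * ((M + 1 - k % 2) / 2) := by omega
  have h3 : (M : ℝ) ≤ 3 * ((M + 1 - k % 2) / 2 : ℕ) := by exact_mod_cast h2
  linarith

theorem parityWeight_nonneg {M : ℕ} (m : Fin M) (k : ℕ) : 0 ≤ parityWeight m k := by
  unfold parityWeight; split_ifs <;> norm_num

theorem parityWeight_le_one {M : ℕ} (m : Fin M) (k : ℕ) : parityWeight m k ≤ 1 := by
  unfold parityWeight; split_ifs <;> norm_num

theorem meanWeight_le_one {M : ℕ} (hM : 0 < M) {w : Fin M → ℕ → ℝ} (hw : ∀ m k, w m k ≤ 1)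
    (k : ℕ) : Profile.meanWeight w k ≤ 1 := by
  rw [Profile.meanWeight, div_le_one (by exact_mod_cast hM)]
  exact (Finset.sum_le_sum fun m _ => hw m k).trans (by simp)

theorem meanWeight_one {M : ℕ} (hM : 0 < M) (k : ℕ) :
    Profile.meanWeight (fun (_ : Fin M) _ => 1) k = 1 := by
  have : (M : ℝ) ≠ 0 := by positivity
  simp [Profile.meanWeight, this]

/-- The amplitude `a = Δ/(8T)` spends the whole suboptimality budget; then `aμ²` is the scale of the
Hessian and `(aμ)²` that of the squared gradient. -/
theorem exists_scale {T : ℕ} {Δ θ : ℝ} (hT : 0 < T) (hΔ : 0 < Δ) (hθ : 0 ≤ θ) :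
    ∃ a μ : ℝ, 0 ≤ a ∧ 0 ≤ μ ∧ 8 * T * a ≤ Δ ∧ a * μ ^ 2 = θ ∧ (a * μ) ^ 2 = Δ * θ / (8 * T) := by
  have hT' : (0 : ℝ) < T := by exact_mod_cast hT
  have ha : 0 < Δ / (8 * T) := by positivity
  have h : Δ / (8 * T) * √(θ / (Δ / (8 * T))) ^ 2 = θ := by
    rw [Real.sq_sqrt (by positivity)]; field_simp
  refine ⟨Δ / (8 * T), √(θ / (Δ / (8 * T))), ha.le, Real.sqrt_nonneg _, ?_, h, ?_⟩
  · rw [mul_div_cancel₀]; positivity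
  · rw [mul_pow, sq (Δ / (8 * T)), mul_assoc, h]; ring

theorem forces_heterogeneous (P : Profile) {M K R : ℕ} {H Δ τ ζ σ : ℝ} (hM : 2 ≤ M) (hR : 1 ≤ R)
    (hH : 0 < H) (hΔ : 0 < Δ) (hτ : 0 ≤ τ) (hτH : τ ≤ 2 * H) (hζ : 0 ≤ ζ) :
    Forces M K R H Δ τ ζ σ
      (1 / (23040 * P.L ^ 2) * min (H ^ 2 * ζ ^ 2 / R) (Δ * τ / R)) := by
  have hL := P.two_le_L
  have hL0 := P.L_pos
  have hM0 : 0 < M := by omega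
  have hR' : (1 : ℝ) ≤ R := by exact_mod_cast hR
  set v := min (H ^ 2 * ζ ^ 2) (Δ * τ) with hv
  have hv0 : 0 ≤ v := le_min (by positivity) (by positivity)
  -- Small enough for both constraints: `v ≤ Δτ` keeps `12Lθ` below `τ/4`, hence below `H` as `τ ≤
  -- 2H`, and `v ≤ H²ζ²` bounds the gradient differences.
  set θ := v / (24 * P.L ^ 2 * Δ) with hθ
  have hθ0 : 0 ≤ θ := by positivity
  have hθΔ : Δ * θ * (24 * P.L ^ 2) = v := by rw [hθ]; field_simp
  obtain ⟨a, μ, ha, hμ, h8, haμ, hsq⟩ := exists_scale (T := R + 1) (by omega) hΔ hθ0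
  have hθτ : θ * (12 * P.L) ≤ τ / 4 := by
    have h1 : v ≤ Δ * τ := min_le_right _ _
    rw [hθ, div_mul_eq_mul_div, div_le_iff₀ (by positivity)]
    have h2 : v * (12 * P.L) ≤ Δ * τ * (12 * P.L) := mul_le_mul_of_nonneg_right h1 (by positivity)
    nlinarith [mul_nonneg (mul_nonneg hΔ.le hτ) (mul_nonneg hL0.le (sub_nonneg.2 hL))]
  have hin : InClass (fun m => (P.scaled a μ (parityWeight (M := M) m) : Vec (R + 1) → ℝ))
      H Δ τ ζ := by
    refine P.scaled_inClass hM0 ha hμ (by rw [haμ]; linarith) h8 hτ (by positivity)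
      parityWeight_nonneg parityWeight_le_one (Or.inr ⟨by rw [haμ]; linarith, ?_⟩)
    have h1 : v ≤ H ^ 2 * ζ ^ 2 := min_le_left _ _
    rw [hsq]
    calc Δ * θ / (8 * (R + 1 : ℕ)) * (9 * P.L ^ 2 * (R + 1 : ℕ)) = 9 / 192 * v := by
          rw [← hθΔ]; push_cast; field_simp; ring
      _ ≤ (H * ζ) ^ 2 := by rw [mul_pow]; linarith
  refine ⟨R + 1, _, exactOracle _, hin, exactOracle_isFor hin σ, fun A => ?_⟩
  refine le_trans ?_ (le_expectedError_exactOracle A (e := ENNReal.ofReal ((a * μ) ^ 2 / 36))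
    fun z hz => ?_)
  · refine ENNReal.ofReal_le_ofReal ?_
    have e : 1 / (23040 * P.L ^ 2) * min (H ^ 2 * ζ ^ 2 / R) (Δ * τ / R)
        = Δ * θ / (960 * R) := by
      rw [min_div_div_right (by positivity), ← hv, ← hθΔ]; field_simp; ring
    rw [e, hsq, div_div]
    push_cast
    exact div_le_div_of_nonneg_left (by positivity) (by positivity) (by linarith)
  · refine P.le_enorm_gradient_avg_scaled hM0 (meanWeight_le_one hM0 parityWeight_le_one)
      (third_le_meanWeight_parity hM) (N := R) (by omega) ?_
    refine supp_output_subset A (exactOracle _) z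
      -- In round `r` a machine of the parity of `r` can reveal coordinate `r` and is then stuck;
      -- the others are stuck at once. Further local calls gain nothing, so the same count serves
      -- before and after each call.
      (fun r _ m => r.val + if r.val % 2 = m.val % 2 then 1 else 0)
      (fun r _ m => r.val + if r.val % 2 = m.val % 2 then 1 else 0) R ?_ ?_ ?_ ?_
    · intro r k m x hx
      change supp (gradient (P.scaled a μ (parityWeight (z (r, k, m)))) x) ⊆ _
      rw [hz, P.gradient_scaled]
      refine supp_smul_subset_prefix _
        (P.supp_chainGrad_subset_of_weight_eq_zero (supp_smul_subset_prefix _ hx) _ ?_)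
      rw [parityWeight, if_neg]
      change ¬ (r.val + if r.val % 2 = m.val % 2 then 1 else 0) % 2 = m.val % 2
      split_ifs <;> omega
    · intro r' r _ _ m' m h
      have h' : r'.val < r.val := h
      split_ifs <;> omega
    · intro r _ _ m _; exact le_rfl
    · intro r _ m
      have := r.isLt
      split_ifs <;> omega

theorem forces_sequential (P : Profile) {M K R : ℕ} {H Δ τ ζ σ : ℝ} (hM : 2 ≤ M) (hK : 1 ≤ K)
    (hR : 1 ≤ R) (hH : 0 < H) (hΔ : 0 < Δ) (hτ : 0 ≤ τ) (hζ : 0 ≤ ζ) :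
    Forces M K R H Δ τ ζ σ (1 / (23040 * P.L ^ 2) * (Δ * H / (K * R))) := by
  have hL := P.two_le_L
  have hL0 := P.L_pos
  have hM0 : 0 < M := by omega
  have hRK : 1 ≤ R * K := Nat.mul_pos hR hK
  have hRK' : (1 : ℝ) ≤ R * K := by exact_mod_cast hRK
  set θ := H / (12 * P.L) with hθ
  -- At most `RK` coordinates are revealed; one more is kept that stays zero.
  obtain ⟨a, μ, ha, hμ, h8, haμ, hsq⟩ := exists_scale (T := R * K + 1) (θ := θ) (by omega) hΔ
    (by positivity)
  have hin : InClass (fun _ : Fin M => (P.scaled a μ (fun _ => 1) : Vec (R * K + 1) → ℝ))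
      H Δ τ ζ :=
    P.scaled_inClass hM0 ha hμ (by rw [haμ, hθ, div_mul_cancel₀]; positivity) h8 hτ
      (by positivity) (fun _ _ => zero_le_one) (fun _ _ => le_rfl) (Or.inl fun _ _ => rfl)
  refine ⟨R * K + 1, _, exactOracle _, hin, exactOracle_isFor hin σ, fun A => ?_⟩
  refine le_trans ?_ (le_expectedError_exactOracle A (e := ENNReal.ofReal ((a * μ) ^ 2 / 36))
    fun z _ => ?_)
  · refine ENNReal.ofReal_le_ofReal ?_
    have e : 1 / (23040 * P.L ^ 2) * (Δ * H / (K * R)) = Δ * θ / (1920 * P.L * (R * K)) := by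
      rw [hθ]; field_simp; norm_num
    rw [e, hsq, div_div]
    push_cast
    exact div_le_div_of_nonneg_left (by positivity) (by positivity) (by nlinarith)
  · refine P.le_enorm_gradient_avg_scaled hM0 (fun k => (meanWeight_one hM0 k).le)
      (fun k => by rw [meanWeight_one hM0 k]; norm_num) (N := R * K) (by omega) ?_
    refine supp_output_subset A (exactOracle _) z (fun r k _ => r.val * K + k.val)
      (fun r k _ => r.val * K + k.val + 1) (R * K) ?_ ?_ ?_ ?_
    · intro r k m x hx
      change supp (gradient (P.scaled a μ (fun _ => 1)) x) ⊆ _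
      rw [P.gradient_scaled]
      exact supp_smul_subset_prefix _
        (P.supp_chainGrad_subset (supp_smul_subset_prefix _ hx) _ _)
    · intro r' r k' k _ _ h
      have h1 : (r'.val + 1) * K ≤ r.val * K := Nat.mul_le_mul_right K h
      have h2 := k'.isLt
      rw [Nat.add_mul] at h1
      omega
    · intro r k' k _ h
      have h' : k'.val < k.val := h
      omega
    · intro r k _
      have h1 : (r.val + 1) * K ≤ R * K := Nat.mul_le_mul_right K r.isLt
      have h2 := k.isLt
      rw [Nat.add_mul] at h1
      omega

/-- Under Bernoulli oracles the progress is at most the number of successes. -/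
theorem supp_output_bernoulli_subset {M K R d : ℕ} (A : ZRAlgorithm M K R d) (F : Vec d → ℝ)
    {G B : Vec d → Vec d} {p : unitInterval}
    (htrue : ∀ c x, supp x ⊆ {i | i.val < c} →
      supp (G x - (1 - (p : ℝ)⁻¹) • B x) ⊆ {i | i.val < c + 1})
    (hfalse : ∀ c x, supp x ⊆ {i | i.val < c} → supp (G x - B x) ⊆ {i | i.val < c})
    (z : Fin R × Fin K × Fin M → Bool) :
    supp (A.output (transcript A (bernoulliOracle M F G B p) z))
      ⊆ {i | i.val < (Finset.univ.filter fun i => z i = true).card} := by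
  classical
  refine supp_output_subset A (bernoulliOracle M F G B p) z
    -- Successes of other machines at earlier calls of the same round are counted although not yet
    -- communicated; this only enlarges the bound and makes it independent of the machine.
    (fun r k _ => (Finset.univ.filter fun i : Fin R × Fin K × Fin M =>
      z i = true ∧ (i.1 < r ∨ i.1 = r ∧ i.2.1 < k)).card)
    (fun r k m => (Finset.univ.filter fun i : Fin R × Fin K × Fin M =>
      z i = true ∧ (i.1 < r ∨ i.1 = r ∧ i.2.1 < k ∨ i = (r, k, m))).card) _ ?_ ?_ ?_ ?_
  · intro r k m x hx
    change supp (G x - (if z (r, k, m) then (1 - (p : ℝ)⁻¹) else 1) • B x) ⊆ _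
    by_cases hz : z (r, k, m) = true
    · rw [if_pos hz]
      refine (htrue _ x hx).trans fun i hi => lt_of_lt_of_le hi
        (Nat.succ_le_of_lt (Finset.card_lt_card ?_))
      refine (Finset.ssubset_iff_of_subset ?_).2 ⟨(r, k, m), ?_, ?_⟩
      · intro i hi
        simp only [Finset.mem_filter, Finset.mem_univ, true_and] at hi ⊢
        tauto
      · simp [hz]
      · simp
    · rw [if_neg hz, one_smul]
      refine (hfalse _ x hx).trans fun i hi => lt_of_lt_of_le hi (Finset.card_le_card ?_)
      intro i hi
      simp only [Finset.mem_filter, Finset.mem_univ, true_and] at hi ⊢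
      tauto
  · intro r' r k' k m' m h
    refine Finset.card_le_card fun i hi => ?_
    simp only [Finset.mem_filter, Finset.mem_univ, true_and] at hi ⊢
    refine ⟨hi.1, Or.inl ?_⟩
    rcases hi.2 with h' | h' | h'
    · exact h'.trans h
    · exact h'.1.trans_lt h
    · rw [h']; exact h
  · intro r k' k m h
    refine Finset.card_le_card fun i hi => ?_
    simp only [Finset.mem_filter, Finset.mem_univ, true_and] at hi ⊢
    refine ⟨hi.1, ?_⟩
    rcases hi.2 with h' | h' | h'
    · exact Or.inl h'
    · exact Or.inr ⟨h'.1, h'.2.trans h⟩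
    · rw [h']; exact Or.inr ⟨rfl, h⟩
  · intro r k m
    refine Finset.card_le_card fun i hi => ?_
    simp only [Finset.mem_filter, Finset.mem_univ, true_and] at hi ⊢
    exact hi.1

theorem forces_stochastic (P : Profile) {M K R : ℕ} {H Δ τ ζ σ : ℝ} (hM : 2 ≤ M) (hK : 1 ≤ K)
    (hR : 1 ≤ R) (hH : 0 < H) (hΔ : 0 < Δ) (hτ : 0 ≤ τ) (hζ : 0 ≤ ζ) (hσ : 0 < σ)
    (hup : σ ^ 2 / (M * K * R) ≤ Δ * H) (hlow : Δ * H ≤ M * K * R * σ ^ 2) :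
    Forces M K R H Δ τ ζ σ
      (1 / (23040 * P.L ^ 2) * (σ * √(Δ * H / (M * K * R)))) := by
  have hL := P.two_le_L
  have hL0 := P.L_pos
  have hM0 : 0 < M := by omega
  set n := M * K * R with hn
  have hn0 : 0 < n := Nat.mul_pos (Nat.mul_pos hM0 hK) hR
  have hn' : (0 : ℝ) < n := by exact_mod_cast hn0
  have hnr : (M : ℝ) * K * R = n := by rw [hn]; push_cast; ring
  rw [hnr] at hup hlow ⊢
  -- The length `T ≈ q` balances the squared gradient scale, of order `ΔH/T`, against the variance
  -- budget `pσ²` with `p = T/(2n)`. The two hypotheses on `σ` say `q ≥ 1` and `q ≤ n`, so rounding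
  -- up at most doubles `q` and `p ≤ 1/2`.
  set q := √(n * (Δ * H) / σ ^ 2) with hq
  have hq2 : q ^ 2 = n * (Δ * H) / σ ^ 2 := Real.sq_sqrt (by positivity)
  have hq1 : 1 ≤ q := by
    rw [hq, Real.one_le_sqrt, one_le_div (by positivity)]
    rwa [div_le_iff₀ hn', mul_comm] at hup
  have hqn : q ≤ n := by
    rw [hq, Real.sqrt_le_left hn'.le, div_le_iff₀ (by positivity)]
    nlinarith
  set T := ⌈q⌉₊ with hT
  have hqT : q ≤ T := Nat.le_ceil q
  have hTq : (T : ℝ) ≤ 2 * q := by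
    have := Nat.ceil_lt_add_one (by linarith : 0 ≤ q)
    linarith
  have hTn : T ≤ n := Nat.ceil_le.2 hqn
  have hT0 : 0 < T := Nat.ceil_pos.2 (by linarith)
  have hT' : (0 : ℝ) < T := by exact_mod_cast hT0
  have hTn' : (T : ℝ) ≤ n := by exact_mod_cast hTn
  set p : unitInterval := ⟨T / (2 * n), by positivity, by
    rw [div_le_one (by positivity)]; linarith⟩ with hp
  have hpv : (p : ℝ) = T / (2 * n) := rfl
  have hp0 : 0 < (p : ℝ) := by rw [hpv]; positivity
  -- `20L = 12L + 2·4L`: the Lipschitz constant of the chain gradient plus twice that of the hidden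
  -- part.
  set θ := H / (20 * P.L) with hθ
  obtain ⟨a, μ, ha, hμ, h8, haμ, hsq⟩ := exists_scale (T := T) (θ := θ) hT0 hΔ (by positivity)
  have hθH : θ * (20 * P.L) = H := div_mul_cancel₀ _ (by positivity)
  have hin : InClass (fun _ : Fin M => (P.scaled a μ (fun _ => 1) : Vec T → ℝ)) H Δ τ ζ :=
    P.scaled_inClass hM0 ha hμ (by
      rw [haμ, ← hθH]
      exact mul_le_mul_of_nonneg_left (by linarith) (by positivity)) h8 hτ
      (by positivity) (fun _ _ => zero_le_one) (fun _ _ => le_rfl) (Or.inl fun _ _ => rfl)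
  have hΔθ : Δ * θ ≤ Δ * H / 40 := by
    rw [← hθH]
    nlinarith [mul_nonneg (mul_nonneg hΔ.le (by positivity : 0 ≤ θ)) (sub_nonneg.2 hL)]
  set B : Vec T → Vec T := fun x => (a * μ) • P.hidden (μ • x) with hB
  refine ⟨T, _, bernoulliOracle M (P.scaled a μ (fun _ => 1)) (P.scaledGrad a μ (fun _ => 1)) B p,
    hin, bernoulliOracle_isFor hp0
      (continuous_iff_continuousAt.2 fun x => (P.hasGradientAt_scaled a μ _ x).continuousAt)
      (P.gradient_scaled a μ _) (P.scaledGrad_lip ha hμ fun _ => by simp)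
      (norm_rescale_sub_le ha hμ P.hidden_lip) ?_ ?_, fun A => ?_⟩
  · rw [haμ, ← hθH]
    linarith
  · intro x
    rw [hB, norm_smul, mul_pow, Real.norm_eq_abs, sq_abs, hsq, hpv]
    refine (mul_le_of_le_one_right (by positivity) (P.norm_hidden_sq_le _)).trans ?_
    have h1 : n * (Δ * H) ≤ T ^ 2 * σ ^ 2 := by
      have := pow_le_pow_left₀ (by linarith) hqT 2
      rwa [hq2, div_le_iff₀ (by positivity)] at this
    rw [div_mul_eq_mul_div, div_le_div_iff₀ (by positivity) (by positivity)]
    nlinarith [mul_nonneg hΔ.le hH.le]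
  · have hle := le_expectedError_bernoulliOracle A
      (F := fun _ : Fin M => (P.scaled a μ (fun _ => 1) : Vec T → ℝ))
      (F₀ := P.scaled a μ (fun _ => 1)) (G := P.scaledGrad a μ (fun _ => 1)) (B := B) (p := p)
      (e := ENNReal.ofReal ((a * μ) ^ 2 / 36)) hT0 (by
        rw [show (R : ℝ) * (K * M) = n by rw [← hnr]; ring, hpv]
        apply le_of_eq; field_simp) (fun z hz => by
        refine P.le_enorm_gradient_avg_scaled hM0 (fun k => (meanWeight_one hM0 k).le)
          (fun k => by rw [meanWeight_one hM0 k]; norm_num) hz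
          (supp_output_bernoulli_subset A _ ?_ ?_ z)
        · intro c x hx
          have hx' := supp_smul_subset_prefix μ hx
          rw [supp_subset_iff]
          intro i hi
          rw [PiLp.sub_apply, PiLp.smul_apply, hB, PiLp.smul_apply, Profile.scaledGrad,
            PiLp.smul_apply, P.chainGrad_apply_of_prefix hx' _ _ (by omega),
            P.hidden_apply_of_prefix hx' (by omega), P.lead_eq_zero hx' (by omega)]
          simp
        · intro c x hx
          have hx' := supp_smul_subset_prefix μ hx
          rw [supp_subset_iff]
          intro i hi
          rw [PiLp.sub_apply, hB, PiLp.smul_apply, Profile.scaledGrad,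
            PiLp.smul_apply, P.chainGrad_apply_of_prefix hx' _ _ hi,
            P.hidden_apply_of_prefix hx' hi]
          simp)
    refine le_trans ?_ hle
    rw [show (2 : ℝ≥0∞)⁻¹ = ENNReal.ofReal (1 / 2) by
      rw [one_div, ENNReal.ofReal_inv_of_pos two_pos, ENNReal.ofReal_ofNat],
      ← ENNReal.ofReal_mul (by positivity)]
    refine ENNReal.ofReal_le_ofReal ?_
    -- The target rate is `ΔH/q`, which `T ≤ 2q` compares with the forced `Δθ/(576T)`.
    have hS : σ * √(Δ * H / n) = Δ * H / q := by
      rw [eq_div_iff (by positivity), hq, mul_assoc, ← Real.sqrt_mul (by positivity),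
        show Δ * H / n * (n * (Δ * H) / σ ^ 2) = (Δ * H / σ) ^ 2 by field_simp,
        Real.sqrt_sq (by positivity)]
      field_simp
    have e : 1 / (23040 * P.L ^ 2) * (Δ * H / q) = Δ * θ / (1152 * P.L * q) := by
      rw [hθ]; field_simp; norm_num
    rw [hS, e, hsq, show Δ * θ / (8 * T) / 36 * (1 / 2) = Δ * θ / (576 * T) by ring]
    exact div_le_div_of_nonneg_left (by positivity) (by positivity) (by nlinarith)

/-- For `Δ = 0` the scale `μ` of `exists_scale` is not available. The noise hypothesis of the lower
bound then forces `σ = 0`, all its terms vanish, and any member of the class will do. -/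
theorem forces_zero {M K R : ℕ} {H τ ζ σ : ℝ} (P : Profile) (hM : 2 ≤ M) (hH : 0 < H)
    (hτ : 0 ≤ τ) (hζ : 0 ≤ ζ) : Forces M K R H 0 τ ζ σ 0 := by
  have hin : InClass (fun _ : Fin M => (P.scaled 0 0 (fun _ => 1) : Vec 0 → ℝ)) H 0 τ ζ :=
    P.scaled_inClass (by omega) le_rfl le_rfl (by simpa using hH.le) (by simp) hτ
      (by positivity) (fun _ _ => zero_le_one) (fun _ _ => le_rfl) (Or.inl fun _ _ => rfl)
  exact ⟨0, _, exactOracle _, hin, exactOracle_isFor hin σ, fun A => by simp⟩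

/-! ### Combination of the lower bounds -/

theorem rpow_two_thirds_le {x y : ℝ} (hx : 0 ≤ x) (hy : 0 ≤ y) (h : x ^ 2 ≤ y ^ 3) :
    x ^ ((2 : ℝ) / 3) ≤ y := by
  have h1 : x ^ ((2 : ℝ) / 3) = (x ^ 2) ^ ((1 : ℝ) / 3) := by
    rw [← Real.rpow_natCast x 2, ← Real.rpow_mul hx]; norm_num
  have h2 : (y ^ 3) ^ ((1 : ℝ) / 3) = y := by
    rw [← Real.rpow_natCast y 3, ← Real.rpow_mul hy]; norm_num
  rw [h1, ← h2]
  exact Real.rpow_le_rpow (sq_nonneg x) h (by norm_num)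

/-- The stochastic terms of the lower bound are dominated by the sequential one if the noise is
small, and by the rate `σ √(u / n)` otherwise. -/
theorem stochastic_terms_le {σ u n : ℝ} (hσ : 0 ≤ σ) (hu : 0 ≤ u) (hn : 1 ≤ n)
    (hup : σ ^ 2 / n ≤ u) :
    (n * σ ^ 2 ≤ u ∧ σ ^ 2 / n + (σ * u / n) ^ ((2 : ℝ) / 3) ≤ 2 * (u / n)) ∨
      (u < n * σ ^ 2 ∧ σ ^ 2 / n + (σ * u / n) ^ ((2 : ℝ) / 3) ≤ 2 * (σ * √(u / n))) := by
  have hn0 : 0 < n := by linarith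
  rcases le_or_gt (n * σ ^ 2) u with h | h
  · refine Or.inl ⟨h, ?_⟩
    have h1 : σ ^ 2 / n ≤ u / n := by
      refine div_le_div_of_nonneg_right ?_ hn0.le
      nlinarith [sq_nonneg σ]
    have h2 : (σ * u / n) ^ ((2 : ℝ) / 3) ≤ u / n := by
      refine rpow_two_thirds_le (by positivity) (by positivity) ?_
      rw [div_pow, div_pow, div_le_div_iff₀ (by positivity) (by positivity)]
      have := mul_le_mul_of_nonneg_right h (by positivity : 0 ≤ u ^ 2 * n ^ 2)
      nlinarith
    linarith
  · refine Or.inr ⟨h, ?_⟩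
    -- The case assumption is `s ≤ σ` up to strictness, and `hup` is `σ/n ≤ s`; these give
    -- `(σs²)^(2/3) ≤ σs` and `σ²/n ≤ σs`.
    set s := √(u / n) with hs
    have hs0 : 0 ≤ s := Real.sqrt_nonneg _
    have hs2 : s ^ 2 = u / n := Real.sq_sqrt (by positivity)
    have hsu : u = n * s ^ 2 := by rw [hs2]; field_simp
    have hsσ : s ≤ σ := by
      refine le_of_sq_le_sq ?_ hσ
      rw [hs2, div_le_iff₀ hn0]; linarith
    have hσs : σ / n ≤ s := by
      refine le_of_sq_le_sq ?_ hs0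
      rw [div_pow, hs2, div_le_div_iff₀ (by positivity) hn0]
      rw [div_le_iff₀ hn0] at hup
      nlinarith
    have h1 : σ ^ 2 / n ≤ σ * s := by
      rw [sq, mul_div_assoc]; exact mul_le_mul_of_nonneg_left hσs hσ
    have h2 : (σ * u / n) ^ ((2 : ℝ) / 3) ≤ σ * s := by
      refine rpow_two_thirds_le (by positivity) (by positivity) ?_
      have e : σ * u / n = σ * s ^ 2 := by rw [hsu]; field_simp
      rw [e]
      have := mul_le_mul_of_nonneg_left hsσ (by positivity : 0 ≤ σ ^ 2 * s ^ 3)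
      nlinarith
    linarith

theorem exists_lower_bound : ∃ c : ℝ, 0 < c ∧ ∀ (M K R : ℕ) (H Δ τ ζ σ : ℝ),
    2 ≤ M → 1 ≤ K → 1 ≤ R → 0 < H → 0 ≤ Δ → 0 ≤ τ → τ ≤ 2 * H → 0 ≤ ζ → 0 ≤ σ →
    σ ^ 2 / (M * K * R) ≤ Δ * H →
    Forces M K R H Δ τ ζ σ (c * (min (H ^ 2 * ζ ^ 2 / R) (Δ * τ / R) + Δ * H / (K * R)
      + σ ^ 2 / (M * K * R) + (σ * Δ * H / (M * K * R)) ^ ((2 : ℝ) / 3))) := by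
  obtain ⟨P⟩ := exists_profile
  have hL := P.L_pos
  set c₀ := 1 / (23040 * P.L ^ 2) with hc₀
  have hc : 0 < c₀ := by positivity
  refine ⟨c₀ / 5, by positivity, ?_⟩
  intro M K R H Δ τ ζ σ hM hK hR hH hΔ hτ hτH hζ hσ hup
  have hMr : (1 : ℝ) ≤ M := by exact_mod_cast (by omega : 1 ≤ M)
  have hKr : (1 : ℝ) ≤ K := by exact_mod_cast hK
  have hRr : (1 : ℝ) ≤ R := by exact_mod_cast hR
  have hKR : (1 : ℝ) ≤ K * R := one_le_mul_of_one_le_of_one_le hKr hRr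
  have hn : (1 : ℝ) ≤ M * K * R := by
    rw [mul_assoc]; exact one_le_mul_of_one_le_of_one_le hMr hKR
  set t₁ := min (H ^ 2 * ζ ^ 2 / R) (Δ * τ / R) with ht₁
  set t₂ := Δ * H / (K * R) with ht₂
  have ht₁0 : 0 ≤ t₁ := le_min (by positivity) (by positivity)
  have ht₂0 : 0 ≤ t₂ := by positivity
  rcases hΔ.eq_or_lt with h0 | hΔ'
  · subst h0
    have hσ0 : σ = 0 := by
      rw [zero_mul, div_le_iff₀ (by positivity), zero_mul] at hup
      exact pow_eq_zero_iff two_ne_zero |>.1 (le_antisymm hup (sq_nonneg σ))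
    have ht1' : t₁ ≤ 0 := (min_le_right _ _).trans (by simp)
    refine (forces_zero P hM hH hτ hζ).mono ?_
    rw [hσ0, ht₂]
    simp [le_antisymm ht1' ht₁0]
  have f₁ := forces_heterogeneous P (K := K) (σ := σ) hM hR hH hΔ' hτ hτH hζ
  have f₂ := forces_sequential P (σ := σ) hM hK hR hH hΔ' hτ hζ
  rw [← hc₀, ← ht₁] at f₁
  rw [← hc₀, ← ht₂] at f₂
  have hst := stochastic_terms_le hσ (by positivity : 0 ≤ Δ * H) hn hup
  rw [← mul_assoc] at hst
  set X := σ ^ 2 / (M * K * R) + (σ * Δ * H / (M * K * R)) ^ ((2 : ℝ) / 3) with hX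
  -- It suffices that one of the three forced errors, the largest, is at least a fifth of the sum of
  -- the four terms.
  have hgoal : ∀ e, t₁ + t₂ + X ≤ 5 * e → Forces M K R H Δ τ ζ σ (c₀ * e) →
      Forces M K R H Δ τ ζ σ (c₀ / 5 * (t₁ + t₂ + σ ^ 2 / (M * K * R)
        + (σ * Δ * H / (M * K * R)) ^ ((2 : ℝ) / 3))) := by
    intro e he hf
    refine hf.mono ?_
    have := mul_le_mul_of_nonneg_left he hc.le
    rw [hX] at this
    linarith
  rcases hst with ⟨-, h⟩ | ⟨hlow, h⟩
  · have h' : Δ * H / (M * K * R) ≤ t₂ :=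
      div_le_div_of_nonneg_left (by positivity) (by positivity)
        (by rw [mul_assoc]; exact le_mul_of_one_le_left (by positivity) hMr)
    rcases le_total t₁ t₂ with h12 | h12
    · exact hgoal t₂ (by linarith) f₂
    · exact hgoal t₁ (by linarith) f₁
  · have hσ' : 0 < σ := by
      refine hσ.lt_of_ne fun h0 => ?_
      rw [← h0] at hlow
      have : 0 < Δ * H := by positivity
      norm_num at hlow
      linarith
    have f₃ := forces_stochastic P hM hK hR hH hΔ' hτ hζ hσ' hup hlow.le
    rw [← hc₀] at f₃
    set t₃ := σ * √(Δ * H / (M * K * R)) with ht₃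
    have ht₃0 : 0 ≤ t₃ := by positivity
    rcases le_total t₁ t₂ with h12 | h12
    · rcases le_total t₂ t₃ with h23 | h23
      · exact hgoal t₃ (by linarith) f₃
      · exact hgoal t₂ (by linarith) f₂
    · rcases le_total t₁ t₃ with h13 | h13
      · exact hgoal t₃ (by linarith) f₃
      · exact hgoal t₁ (by linarith) f₁

/-! ### Minimax optimality -/

theorem Forces.le_minimaxError {M K R : ℕ} {H Δ τ ζ σ e : ℝ} (h : Forces M K R H Δ τ ζ σ e) :
    ENNReal.ofReal e ≤ minimaxError M K R H Δ τ ζ σ := by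
  obtain ⟨d, F, O, hF, hO, hA⟩ := h
  refine le_iInf fun A => (hA (A d)).trans ?_
  exact le_iSup_of_le d (le_iSup_of_le F (le_iSup_of_le O (le_iSup_of_le hF
    (le_iSup_of_le hO le_rfl))))

end DistOpt

theorem mainTheorem9 :
    (∃ c : ℝ, 0 < c ∧ ∀ (M K R : ℕ) (H Δ τ ζ σ : ℝ),
      2 ≤ M → 1 ≤ K → 1 ≤ R → 0 < H → 0 ≤ Δ → 0 ≤ τ → τ ≤ 2 * H → 0 ≤ ζ → 0 ≤ σ →
      σ ^ 2 / (M * K * R) ≤ Δ * H →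
      ∃ (d : ℕ) (F : Fin M → DistOpt.Vec d → ℝ) (O : DistOpt.Oracle M d),
        DistOpt.InClass F H Δ τ ζ ∧ O.IsFor F H σ ∧
        ∀ A : DistOpt.ZRAlgorithm M K R d,
          ENNReal.ofReal (c * (min (H ^ 2 * ζ ^ 2 / R) (Δ * τ / R) + Δ * H / (K * R)
            + σ ^ 2 / (M * K * R) + (σ * Δ * H / (M * K * R)) ^ ((2 : ℝ) / 3)))
          ≤ DistOpt.expectedError A F O) ∧
    (∃ a C : ℝ, 0 < a ∧ 0 < C ∧ ∀ (M K N : ℕ) (H Δ τ ζ : ℝ),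
      2 ≤ M → 1 ≤ K → 2 ≤ N → 0 < H → 0 ≤ Δ → 0 ≤ τ → τ ≤ 2 * H → 0 ≤ ζ →
      Δ * τ ≤ H ^ 2 * ζ ^ 2 →
      ∀ (d : ℕ) (F : Fin M → DistOpt.Vec d → ℝ), DistOpt.InClass F H Δ τ ζ →
        ENNReal.ofReal (DistOpt.celsgdError (a / max H (K * τ)) K N F)
          ≤ ENNReal.ofReal C * DistOpt.minimaxError M K (2 * N) H Δ τ ζ 0) := by
  obtain ⟨c, hc, hlb⟩ := DistOpt.exists_lower_bound
  -- The factor `8` comes from `celsgdError_le`, the factor `2` from the two communication rounds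
  -- per iteration.
  refine ⟨⟨c, hc, hlb⟩, 1 / 2, 16 / c, by norm_num, by positivity, ?_⟩
  intro M K N H Δ τ ζ hM hK hN hH hΔ hτ hτH hζ hle d F hF
  have hK' : (0 : ℝ) < K := by exact_mod_cast hK
  have hN' : (0 : ℝ) < N := by exact_mod_cast (by omega : 0 < N)
  have hlow := (hlb M K (2 * N) H Δ τ ζ 0 hM hK (by omega) hH hΔ hτ hτH hζ le_rfl
    (by simp only [ne_eq, OfNat.ofNat_ne_zero, not_false_eq_true, zero_pow, zero_div]
        positivity)).le_minimaxError
  refine le_trans ?_ (mul_le_mul_right hlow _)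
  rw [← ENNReal.ofReal_mul (by positivity)]
  refine ENNReal.ofReal_le_ofReal
    ((DistOpt.celsgdError_le (by omega) hF hH hΔ hτ hK hN).trans (le_of_eq ?_))
  -- The assumption `Δτ ≤ H²ζ²` selects `Δτ/R` in the minimum, the heterogeneity term of the upper
  -- bound.
  rw [min_eq_right (div_le_div_of_nonneg_right hle (by positivity))]
  have h0 : (0 * Δ * H / (M * K * (2 * N : ℕ))) ^ ((2 : ℝ) / 3) = 0 := by
    rw [zero_mul, zero_mul, zero_div]; exact Real.zero_rpow (by norm_num)
  rw [h0]
  push_cast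
  field_simp
  ring
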